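/- Let $\mathcal H$ be a complex Hilbert space, let $U$ be a unitary operator on $\mathcal H$ (no further condition is imposed on $U$), and let $\gamma=\mathrm{ad}(U)$, $\gamma(A)=UAU^*$, be the induced automorphism of the compact operators $\mathcal K(\mathcal H)$, extended by the same formula to $\mathcal B(\mathcal H)$. For $z\in\mathbb C$ let $E_z$ be the selfadjoint projection onto $\{x : Ux=zx\}$, let $\sigma_{\rm pp}(U)$ be the set of eigenvalues of $U$, and put $$\sigma_{\rm pp}^{\rm a}(U)=\{z\in\sigma_{\rm pp}(U) : zw=1 \text{ for some } w\in\sigma_{\rm pp}(U)\}.$$ Let $T$ be a positive trace class operator on $\mathcal H$ with $\mathrm{Tr}(T)=1$ whose support projection is dominated by $E_1$, and let $\omega_T(A)=\mathrm{Tr}(TA)$ for $A\in\mathcal B(\mathcal H)$. Let $k\ge 1$, let $\alpha:\{1,\dots,2k\}\to\{1,\dots,k\}$ be a pair partition (every preimage $\alpha^{-1}(\{j\})$ has exactly two elements), let $A_0,A_{2k}\in\mathcal B(\mathcal H)$ and $A_1,\dots,A_{2k-1}\in\mathcal K(\mathcal H)$. For finite $F\subset\sigma_{\rm pp}^{\rm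 a}(U)$ put $$S^F_{\alpha;A_1,\dots,A_{2k-1}}=\sum_{z_1,\dots,z_k\in F}E_{z^\#_{\alpha(1)}}A_1E_{z^\#_{\alpha(2)}}\cdots E_{z^\#_{\alpha(2k-1)}}A_{2k-1}E_{z^\#_{\alpha(2k)}},$$ where, for $\alpha^{-1}(\{j\})=\{i<i'\}$, $z^\#_{\alpha(i)}=\bar z_j$ and $z^\#_{\alpha(i')}=z_j$. Then the net $S^F_{\alpha;A_1,\dots,A_{2k-1}}$, over the finite subsets $F$ of $\sigma_{\rm pp}^{\rm a}(U)$ directed by inclusion, converges in the strong operator topology to an operator $S_{\alpha;A_1,\dots,A_{2k-1}}\in\mathcal B(\mathcal H)$, and $$\lim_{N\to\infty}\frac1{N^k}\sum_{n_1,\dots,n_k=0}^{N-1}\omega_T\Big(A_0\,\gamma^{n_{\alpha(1)}}(A_1)\,\gamma^{n_{\alpha(1)}+n_{\alpha(2)}}(A_2)\cdots\gamma^{\sum_{l=1}^{2k-1}n_{\alpha(l)}}(A_{2k-1})\,\gamma^{\sum_{i=1}^{k}2n_i}(A_{2k})\Big)=\omega_T\big(A_0\,S_{\alpha;A_1,\dots,A_{2k-1}}\,A_{2k}\big).$$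 -/

import Mathlib

open Filter Topology

noncomputable section

namespace EntangledErgodic

variable {H : Type*} [NormedAddCommGroup H] [InnerProductSpace ℂ H] [CompleteSpace H]

/-- A pair partition of a set of `2k` elements into `k` parts: every fibre has exactly two elements
(in particular `α` is surjective). The point `i ∈ {1, …, 2k}` is represented by `i - 1 : Fin (2 * k)`. -/
def IsPairPartition {k : ℕ} (α : Fin (2 * k) → Fin k) : Prop :=
  ∀ j : Fin k, (Finset.univ.filter fun i => α i = j).card = 2

/-- The pure point spectrum: the set of all the eigenvalues of `U`. -/
def purePointSpectrum (U : unitary (H →L[ℂ] H)) : Set ℂ :=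
  {z | Module.End.HasEigenvalue ((U : H →L[ℂ] H) : H →ₗ[ℂ] H) z}

/-- The antidiagonal part of the pure point spectrum. -/
def antidiagonalSpectrum (U : unitary (H →L[ℂ] H)) : Set ℂ :=
  {z | z ∈ purePointSpectrum U ∧ ∃ w ∈ purePointSpectrum U, z * w = 1}

/-- The closed subspace `{x | U x = z x}`. -/
def eigenspaceOf (U : unitary (H →L[ℂ] H)) (z : ℂ) : Submodule ℂ H :=
  Module.End.eigenspace ((U : H →L[ℂ] H) : H →ₗ[ℂ] H) z

instance (U : unitary (H →L[ℂ] H)) (z : ℂ) : CompleteSpace (eigenspaceOf U z) :=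
  (ContinuousLinearMap.isClosed_eigenspace (U : H →L[ℂ] H) z).completeSpace_coe

/-- `E_z`, the selfadjoint projection onto the eigenspace of `U` at `z`. -/
def eigenProj (U : unitary (H →L[ℂ] H)) (z : ℂ) : H →L[ℂ] H :=
  (eigenspaceOf U z).starProjection

/-- `z^#` at the position `i`: the two positions of the pair `α ⁻¹ {j}` carry `conj z_j` (at the
first one) and `z_j` (at the second one). -/
def alternating {k : ℕ} (α : Fin (2 * k) → Fin k) (z : Fin k → ℂ) (i : Fin (2 * k)) : ℂ :=
  if ∃ l, l < i ∧ α l = α i then z (α i) else starRingEnd ℂ (z (α i))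

/-- The product `E_1 A_1 E_2 A_2 ⋯ E_{2k-1} A_{2k-1} E_{2k}`; the `i`-th factor (from `0`) is
`E i * A i`, except for the last one, which is `E i` only. -/
def interlace {k : ℕ} (A : Fin (2 * k - 1) → (H →L[ℂ] H)) (E : Fin (2 * k) → (H →L[ℂ] H)) :
    H →L[ℂ] H :=
  (List.ofFn fun i : Fin (2 * k) =>
    if h : (i : ℕ) < 2 * k - 1 then E i * A ⟨i, h⟩ else E i).prod

/-- The operator `S^F_{α; A_1, …, A_{2k-1}}`, for a finite subset `F` of the antidiagonal part of
the pure point spectrum of `U`. -/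
def partialEntangled {k : ℕ} (U : unitary (H →L[ℂ] H)) (α : Fin (2 * k) → Fin k)
    (A : Fin (2 * k - 1) → (H →L[ℂ] H)) (F : Finset (antidiagonalSpectrum U)) : H →L[ℂ] H :=
  ∑ z ∈ Fintype.piFinset (fun _ : Fin k => F),
    interlace A fun i => eigenProj U (alternating α (fun j => (z j : ℂ)) i)

/-- `S` is `S_{α; A_1, …, A_{2k-1}}`: the limit, in the strong operator topology, of the net
`S^F_{α; A_1, …, A_{2k-1}}` over the finite sets `F` directed by inclusion. -/
def IsEntangledLimit {k : ℕ} (U : unitary (H →L[ℂ] H)) (α : Fin (2 * k) → Fin k)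
    (A : Fin (2 * k - 1) → (H →L[ℂ] H)) (S : H →L[ℂ] H) : Prop :=
  ∀ x : H, Tendsto (fun F : Finset (antidiagonalSpectrum U) => partialEntangled U α A F x)
    atTop (𝓝 (S x))

/-- The automorphism `γ = ad(U)`, `γ(A) = U A U*`. -/
def ad (U : unitary (H →L[ℂ] H)) : (H →L[ℂ] H) ≃⋆ₐ[ℂ] (H →L[ℂ] H) :=
  Unitary.conjStarAlgAut ℂ (H →L[ℂ] H) U

/-- The trace, computed in the orthonormal basis `e`. It is only used for trace class operators,
for which the series converges absolutely, with a sum that does not depend on `e`. -/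
def trace {ι : Type*} (e : HilbertBasis ι ℂ H) (A : H →L[ℂ] H) : ℂ :=
  ∑' i, inner ℂ (e i) (A (e i))

/-- `T` is a density matrix: positive, trace class and normalized (for a positive operator,
trace class means that the diagonal in an orthonormal basis is summable). -/
def IsDensityMatrix {ι : Type*} (e : HilbertBasis ι ℂ H) (T : H →L[ℂ] H) : Prop :=
  T.IsPositive ∧ HasSum (fun i => inner ℂ (e i) (T (e i))) 1

/-- `s(T) ≤ E_1`: the support of the selfadjoint `T`, the orthogonal complement of its kernel,
consists of `U`-invariant vectors. -/
def IsSupportedInInvariants (U : unitary (H →L[ℂ] H)) (T : H →L[ℂ] H) : Prop :=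
  (LinearMap.ker (T : H →ₗ[ℂ] H))ᗮ ≤ eigenspaceOf U 1

/-- The multiple correlation operator
`A_0 γ^{n_α(1)}(A_1) γ^{n_α(1) + n_α(2)}(A_2) ⋯ γ^{∑_{l ≤ 2k-1} n_α(l)}(A_{2k-1})
γ^{∑_i 2 n_i}(A_{2k})`,
where `A_0 = B`, `A_{2k} = C` and the family `A` is `A_1, …, A_{2k-1}`. -/
def correlation {k : ℕ} (γ : (H →L[ℂ] H) ≃⋆ₐ[ℂ] (H →L[ℂ] H)) (α : Fin (2 * k) → Fin k)
    (B : H →L[ℂ] H) (A : Fin (2 * k - 1) → (H →L[ℂ] H)) (C : H →L[ℂ] H) (n : Fin k → ℕ) :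
    H →L[ℂ] H :=
  B * (List.ofFn fun i : Fin (2 * k - 1) =>
      (γ ^ (∑ l ∈ Finset.univ.filter (fun l : Fin (2 * k) => (l : ℕ) ≤ (i : ℕ)), n (α l))) (A i)).prod
    * (γ ^ (∑ i : Fin k, 2 * n i)) C

end EntangledErgodic

end

/-!
Write `n` for the time variables and `W_n = U^{n_α(1)} A_1 ⋯ A_{2k-1} U^{n_α(2k)}`. The powers of `U`
in the correlation operator telescope, leaving `A_0 W_n A_{2k}` followed by a negative power of `U`
(`correlation_eq`). As `T` is supported in the `U`-invariant vectors, that power disappears under the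
trace: with `R = √T`, a selfadjoint Hilbert–Schmidt operator, `Tr (T X) = ∑ ⟨R e_i, X R e_i⟩`
(`trace_mul_eq`) and `U R = R`. By dominated convergence it remains to show that the averages of
`W_n` converge weakly to `S`.

The averages of `W_n` and the operators `S^F` are multilinear in `A_1, …, A_{2k-1}`, with norm at
most `∏ ‖A_i‖`. For `S^F` this holds since it is an average, over independent random signs
`ε_j : F → {±1}`, of words in the contractions `∑_z ε_j(z) E_{z^#}` (`sum_word_eq_sum_signs`). A
compact operator is a norm limit of finite rank operators, so that both convergence statements
reduce to operators `A_i` of rank one. Then everything factorizes over the `k` pairs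
(`inner_entangledWord_rankOne`, `inner_averagedWord_rankOne`), and the claim becomes, for each pair,
`(1/N) ∑_{n<N} ⟨y, Uⁿ x⟩ ⟨y', Uⁿ x'⟩ → ∑_z ⟨y, E_{z̄} x⟩ ⟨y', E_z x'⟩`
(`tendsto_pairAverage_sub_pairSum`).

If `x'` is an eigenvector of `U`, this is the mean ergodic theorem for a multiple of `U`. If `x'` is
orthogonal to all the eigenvectors, the right hand side is zero, and the left hand side tends to zero
because `(1/N) ∑_{n<N} |⟨y', Uⁿ x'⟩|² → 0` (`tendsto_average_norm_inner_sq`). The latter is proved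
without spectral measures: a weak limit point `K` of the averages of `|Uⁿ x'⟩⟨Uⁿ x'|` is positive, has
finite trace and commutes with `U`. If it were not zero, one of its spectral subspaces would be
nonzero, finite dimensional and invariant under `U`, and would contain an eigenvector `v` of `U` with
`0 < ⟨v, K v⟩ = |⟨v, x'⟩|² = 0`.
-/

noncomputable section

namespace EntangledErgodic

/-! ### Approximation by operators of rank one, and weak limits -/

section

section Density

variable {a V G : Type*} [NormedAddCommGroup V] [NormedSpace ℂ V]
  [NormedAddCommGroup G] [NormedSpace ℂ G]

theorem tendsto_zero_of_mem_closure_span {l : Filter a} {φ : a → V →ₗ[ℂ] G} {C : ℝ}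
    (hφ : ∀ i v, ‖φ i v‖ ≤ C * ‖v‖) {D : Set V} (hD : ∀ v ∈ D, Tendsto (fun i => φ i v) l (𝓝 0))
    {v : V} (hv : v ∈ closure (Submodule.span ℂ D : Set V)) :
    Tendsto (fun i => φ i v) l (𝓝 0) := by
  have hspan : ∀ w ∈ Submodule.span ℂ D, Tendsto (fun i => φ i w) l (𝓝 0) := by
    intro w hw
    induction hw using Submodule.span_induction with
    | mem w hw => exact hD w hw
    | zero => simpa using tendsto_const_nhds
    | add x y _ _ hx hy => simpa using hx.add hy
    | smul c x _ hx => simpa using hx.const_smul c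
  rw [Metric.tendsto_nhds]
  intro ε hε
  have hC : 0 < |C| + 1 := by positivity
  obtain ⟨w, hw, hvw⟩ := Metric.mem_closure_iff.1 hv (ε / 2 / (|C| + 1)) (by positivity)
  filter_upwards [Metric.tendsto_nhds.1 (hspan w hw) (ε / 2) (by positivity)] with i hi
  rw [dist_zero_right] at hi ⊢
  have h1 : ‖φ i (v - w)‖ ≤ ε / 2 := by
    rw [dist_eq_norm] at hvw
    calc ‖φ i (v - w)‖ ≤ C * ‖v - w‖ := hφ _ _
      _ ≤ (|C| + 1) * ‖v - w‖ := by
        gcongr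
        linarith [le_abs_self C]
      _ ≤ (|C| + 1) * (ε / 2 / (|C| + 1)) := by gcongr
      _ = ε / 2 := by field_simp
  have h2 : φ i v = φ i (v - w) + φ i w := by simp
  rw [h2]
  linarith [norm_add_le (φ i (v - w)) (φ i w)]

/-- A uniformly bounded family of multilinear maps that tends to zero on the tuples of elements of
`D` also tends to zero on the tuples of elements of the closed span of `D`. -/
theorem tendsto_zero_of_forall_mem_closure_span {n : ℕ} {l : Filter a}
    {φ : a → MultilinearMap ℂ (fun _ : Fin n => V) G} {C : ℝ}
    (hφ : ∀ i v, ‖φ i v‖ ≤ C * ∏ j, ‖v j‖) {D : Set V}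
    (hD : ∀ v, (∀ j, v j ∈ D) → Tendsto (fun i => φ i v) l (𝓝 0))
    {v : Fin n → V} (hv : ∀ j, v j ∈ closure (Submodule.span ℂ D : Set V)) :
    Tendsto (fun i => φ i v) l (𝓝 0) := by
  suffices H : ∀ s : Finset (Fin n), ∀ v : Fin n → V,
      (∀ j ∈ s, v j ∈ closure (Submodule.span ℂ D : Set V)) → (∀ j ∉ s, v j ∈ D) →
      Tendsto (fun i => φ i v) l (𝓝 0) from
    H Finset.univ v (fun j _ => hv j) (by simp)
  intro s
  induction s using Finset.induction_on with
  | empty => exact fun v _ h => hD v fun j => h j (by simp)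
  | insert j s hj ih =>
    intro v h1 h2
    have key : Tendsto (fun i => (φ i).toLinearMap v j (v j)) l (𝓝 0) := by
      refine tendsto_zero_of_mem_closure_span (D := D)
        (C := C * ∏ i ∈ Finset.univ.erase j, ‖v i‖) ?_ ?_ (h1 j (by simp))
      · intro i w
        rw [MultilinearMap.toLinearMap_apply]
        refine (hφ i _).trans (le_of_eq ?_)
        rw [← Finset.mul_prod_erase _ _ (Finset.mem_univ j), Function.update_self, mul_assoc,
          mul_comm ‖w‖]
        congr 2
        refine Finset.prod_congr rfl fun i hi => ?_
        rw [Function.update_of_ne (Finset.ne_of_mem_erase hi)]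
      · intro w hw
        simp only [MultilinearMap.toLinearMap_apply]
        refine ih _ (fun i hi => ?_) (fun i hi => ?_)
        · rw [Function.update_of_ne (by rintro rfl; exact hj hi)]
          exact h1 i (by simp [hi])
        · by_cases hij : i = j
          · subst hij; simpa using hw
          · rw [Function.update_of_ne hij]
            exact h2 i (by simp [hi, hij])
    simpa using key

end Density

variable {H : Type*} [NormedAddCommGroup H] [InnerProductSpace ℂ H] [CompleteSpace H]

/-- The operators of rank at most one. -/
def rankOneOperators (H : Type*) [NormedAddCommGroup H] [InnerProductSpace ℂ H] :
    Set (H →L[ℂ] H) :=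
  {A | ∃ x y : H, A = InnerProductSpace.rankOne ℂ x y}

/-- A compact operator on a Hilbert space is a norm limit of finite rank operators: it is close to
its compression to the span of a finite net in the image of the unit ball. -/
theorem mem_closure_span_rankOneOperators {A : H →L[ℂ] H} (hA : IsCompactOperator A) :
    A ∈ closure (Submodule.span ℂ (rankOneOperators H) : Set (H →L[ℂ] H)) := by
  rw [Metric.mem_closure_iff]
  intro ε hε
  have htb := (hA.isCompact_closure_image_closedBall (f := (A : H →ₗ[ℂ] H)) 1).totallyBounded
  obtain ⟨t, ht, hcov⟩ := Metric.totallyBounded_iff.1 htb (ε / 2) (by positivity)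
  let W : Submodule ℂ H := Submodule.span ℂ t
  have : FiniteDimensional ℂ W := FiniteDimensional.span_of_finite ℂ ht
  refine ⟨W.starProjection * A, ?_, ?_⟩
  · let b := stdOrthonormalBasis ℂ W
    have : W.starProjection * A =
        ∑ i, InnerProductSpace.rankOne ℂ (b i : H) (ContinuousLinearMap.adjoint A (b i : H)) := by
      rw [b.starProjection_eq_sum_rankOne, Finset.sum_mul]
      exact Finset.sum_congr rfl fun i _ => InnerProductSpace.rankOne_comp _ _ _
    rw [this]
    exact Submodule.sum_mem _ fun i _ => Submodule.subset_span ⟨_, _, rfl⟩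
  · refine lt_of_le_of_lt ?_ (half_lt_self hε)
    rw [dist_eq_norm]
    refine ContinuousLinearMap.opNorm_le_of_unit_norm (by positivity) fun x hx => ?_
    have hmem : A x ∈ closure (A '' Metric.closedBall 0 1) :=
      subset_closure ⟨x, by simp [hx], rfl⟩
    obtain ⟨y, hy, hxy⟩ := Set.mem_iUnion₂.1 (hcov hmem)
    have hyW : y ∈ W := Submodule.subset_span hy
    have := Submodule.starProjection_minimal (U := W) (A x)
    change ‖A x - W.starProjection (A x)‖ ≤ ε / 2
    rw [this]
    refine (ciInf_le ⟨0, by rintro _ ⟨z, rfl⟩; positivity⟩ (⟨y, hyW⟩ : W)).trans ?_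
    rw [← dist_eq_norm]
    exact (Metric.mem_ball.1 hxy).le

/-- Norm bounded families of operators have limits along ultrafilters for the weak operator
topology. -/
theorem exists_weak_limit {a : Type*} (u : Ultrafilter a) {T : a → H →L[ℂ] H} {C : ℝ}
    (hT : ∀ i, ‖T i‖ ≤ C) :
    ∃ K : H →L[ℂ] H, ∀ v w, Tendsto (fun i => inner ℂ v (T i w)) u (𝓝 (inner ℂ v (K w))) := by
  have hb : ∀ v w i, ‖(inner ℂ v (T i w) : ℂ)‖ ≤ C * ‖v‖ * ‖w‖ := fun v w i =>
    calc ‖(inner ℂ v (T i w) : ℂ)‖ ≤ ‖v‖ * ‖T i w‖ := norm_inner_le_norm _ _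
      _ ≤ ‖v‖ * (C * ‖w‖) := by gcongr; exact (T i).le_of_opNorm_le (hT i) w
      _ = C * ‖v‖ * ‖w‖ := by ring
  have hlim : ∀ v w, ∃ c : ℂ, ‖c‖ ≤ C * ‖v‖ * ‖w‖ ∧
      Tendsto (fun i => inner ℂ v (T i w)) u (𝓝 c) := by
    intro v w
    obtain ⟨c, hc, hlim⟩ := (isCompact_closedBall (0 : ℂ) (C * ‖v‖ * ‖w‖)).ultrafilter_le_nhds
      (u.map fun i => inner ℂ v (T i w)) (by
        rw [le_principal_iff]
        exact mem_map.2 (Eventually.of_forall fun i => by simpa using hb v w i))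
    exact ⟨c, by simpa using hc, hlim⟩
  choose B hB hBlim using hlim
  let B' : H →ₗ⋆[ℂ] H →ₗ[ℂ] ℂ := LinearMap.mk₂'ₛₗ (starRingEnd ℂ) (RingHom.id ℂ) B
    (fun v v' w => tendsto_nhds_unique (hBlim _ _) (by
      simpa [inner_add_left] using (hBlim v w).add (hBlim v' w)))
    (fun c v w => tendsto_nhds_unique (hBlim _ _) (by
      simpa [inner_smul_left, mul_comm] using (hBlim v w).const_mul (starRingEnd ℂ c)))
    (fun v w w' => tendsto_nhds_unique (hBlim _ _) (by
      simpa [inner_add_right] using (hBlim v w).add (hBlim v w')))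
    (fun c v w => tendsto_nhds_unique (hBlim _ _) (by
      simpa [inner_smul_right] using (hBlim v w).const_mul c))
  refine ⟨ContinuousLinearMap.adjoint
    (InnerProductSpace.continuousLinearMapOfBilin (B'.mkContinuous₂ C hB)), fun v w => ?_⟩
  rw [ContinuousLinearMap.adjoint_inner_right,
    InnerProductSpace.continuousLinearMapOfBilin_apply]
  exact hBlim v w

end

/-! ### Vectors orthogonal to the eigenvectors are weakly mixing -/

section

variable {H : Type*} [NormedAddCommGroup H] [InnerProductSpace ℂ H] [CompleteSpace H]

/-- A nonzero positive operator `K` of finite trace has a finite dimensional spectral subspace on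
which it is bounded below. An operator commuting with `K` leaves that subspace invariant, and
therefore has an eigenvector in it. -/
theorem exists_eigenvector_of_trace_le {K V : H →L[ℂ] H} (hK : 0 ≤ K) (hK0 : K ≠ 0)
    (hVK : Commute K V) {C : ℝ}
    (hC : ∀ (n : ℕ) (v : Fin n → H), Orthonormal ℂ v → ∑ i, (inner ℂ (v i) (K (v i))).re ≤ C) :
    ∃ (v : H) (μ : ℂ), V v = μ • v ∧ inner ℂ v (K v) ≠ 0 := by
  have : Nontrivial (H →L[ℂ] H) := ⟨⟨K, 0, hK0⟩⟩
  have hsa : IsSelfAdjoint K := IsSelfAdjoint.of_nonneg hK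
  obtain ⟨r, hr, hrK⟩ : ∃ r : ℝ, 0 < r ∧ r < ‖K‖ := exists_between (norm_pos_iff.2 hK0)
  -- `f` vanishes on the part of the spectrum below `r`, and not at the point `‖K‖` of the spectrum
  let f : ℝ → ℝ := fun t => max (t - r) 0
  have hf : Continuous f := by fun_prop
  set G := cfc f K with hG
  have hG0 : G ≠ 0 := by
    intro h0
    have h1 : f ‖K‖ ∈ spectrum ℝ G := by
      rw [hG, cfc_map_spectrum f K]
      exact ⟨_, CStarAlgebra.norm_mem_spectrum_of_nonneg hK, rfl⟩
    rw [h0, spectrum.zero_eq, Set.mem_singleton_iff] at h1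
    have : f ‖K‖ = ‖K‖ - r := max_eq_left (by linarith)
    linarith
  have hlow : ∀ w, r * ‖G w‖ ^ 2 ≤ (inner ℂ (G w) (K (G w))).re := by
    intro w
    have h1 : 0 ≤ cfc (fun t => f t * ((t - r) * f t)) K := by
      refine cfc_nonneg fun t _ => ?_
      rcases le_total t r with h | h
      · simp [f, h]
      · have : f t = t - r := max_eq_left (by linarith)
        rw [this]
        have := sub_nonneg.2 h
        positivity
    have h2 : cfc (fun t => f t * ((t - r) * f t)) K = G * ((K - algebraMap ℝ _ r) * G) := by
      rw [cfc_mul f (fun t => (t - r) * f t) K, cfc_mul (fun t => t - r) f K,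
        cfc_sub (fun t => t) (fun _ => r) K, cfc_id' ℝ K, cfc_const r K]
    rw [h2, ContinuousLinearMap.nonneg_iff_isPositive] at h1
    have h3 := h1.re_inner_nonneg_right w
    have hGsa : IsSelfAdjoint G := cfc_predicate f K
    have h4 : inner ℂ w ((G * ((K - algebraMap ℝ _ r) * G)) w) =
        inner ℂ (G w) (K (G w)) - (r : ℂ) * (‖G w‖ : ℂ) ^ 2 := by
      have : (G * ((K - algebraMap ℝ (H →L[ℂ] H) r) * G)) w = G (K (G w) - r • G w) := by
        simp [mul_apply_eq_comp, Algebra.algebraMap_eq_smul_one]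
      rw [this, ← ContinuousLinearMap.adjoint_inner_left,
        ContinuousLinearMap.isSelfAdjoint_iff'.1 hGsa, inner_sub_right, ← Complex.coe_smul,
        inner_smul_right, inner_self_eq_norm_sq_to_K]
      rfl
    rw [h4] at h3
    have h5 : ((r : ℂ) * (‖G w‖ : ℂ) ^ 2).re = r * ‖G w‖ ^ 2 := by
      rw [← Complex.ofReal_pow, ← Complex.ofReal_mul, Complex.ofReal_re]
    simp only [RCLike.re_to_complex, Complex.sub_re, h5] at h3
    linarith
  let W : Submodule ℂ H := LinearMap.range (G : H →ₗ[ℂ] H)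
  have hWlow : ∀ v ∈ W, r * ‖v‖ ^ 2 ≤ (inner ℂ v (K v)).re := by
    rintro _ ⟨w, rfl⟩
    exact hlow w
  have hfin : FiniteDimensional ℂ W := by
    obtain ⟨d, hd⟩ := exists_nat_ge (C / r)
    rw [FiniteDimensional, ← Module.rank_lt_aleph0_iff]
    refine (rank_le (n := d) fun s hs => ?_).trans_lt Cardinal.natCast_lt_aleph0
    let X : Submodule ℂ W := Submodule.span ℂ (s : Set W)
    have hX : Module.finrank ℂ X = s.card := finrank_span_finset_eq_card hs
    let b := stdOrthonormalBasis ℂ X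
    have hb : Orthonormal ℂ fun i => ((b i : W) : H) :=
      (b.orthonormal.comp_linearIsometry X.subtypeₗᵢ).comp_linearIsometry W.subtypeₗᵢ
    have h1 := hC _ _ hb
    have h2 : ∑ i : Fin (Module.finrank ℂ X), r ≤
        ∑ i, (inner ℂ ((b i : W) : H) (K ((b i : W) : H))).re := by
      refine Finset.sum_le_sum fun i _ => ?_
      have := hWlow _ (b i : W).2
      rwa [hb.1 i, one_pow, mul_one] at this
    rw [Finset.sum_const, Finset.card_univ, Fintype.card_fin, nsmul_eq_mul] at h2
    have h3 : (s.card : ℝ) ≤ C / r := by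
      rw [le_div_iff₀ hr, ← hX]
      exact h2.trans h1
    exact_mod_cast h3.trans hd
  have hGV : Commute G V := hVK.cfc_real f
  have hinv : ∀ v ∈ W, (V : H →ₗ[ℂ] H) v ∈ W := by
    rintro _ ⟨w, rfl⟩
    exact ⟨V w, by simpa using DFunLike.congr_fun hGV.eq w⟩
  have hWnt : Nontrivial W := by
    rw [Submodule.nontrivial_iff_ne_bot]
    intro h
    apply hG0
    ext w
    have : G w ∈ W := ⟨w, rfl⟩
    simpa [h] using this
  obtain ⟨μ, hμ⟩ := Module.End.exists_eigenvalue ((V : H →ₗ[ℂ] H).restrict hinv)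
  obtain ⟨v, hv⟩ := hμ.exists_hasEigenvector
  refine ⟨v, μ, by simpa using congrArg Subtype.val hv.apply_eq_smul, fun h0 => ?_⟩
  have h1 := hWlow v v.2
  rw [h0] at h1
  have h2 : 0 < ‖(v : H)‖ := norm_pos_iff.2 (by simpa using hv.2)
  have : 0 < r * ‖(v : H)‖ ^ 2 := by positivity
  simp only [Complex.zero_re] at h1
  linarith

theorem norm_pow_apply (U : unitary (H →L[ℂ] H)) (n : ℕ) (x : H) :
    ‖((U : H →L[ℂ] H) ^ n) x‖ = ‖x‖ := by
  simpa using Unitary.norm_map (U ^ n) x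

/-- The averages over `n < N` of the operators `|Uⁿ x⟩⟨Uⁿ x|`. -/
def averagedRankOne (U : unitary (H →L[ℂ] H)) (x : H) (N : ℕ) : H →L[ℂ] H :=
  (N : ℂ)⁻¹ • ∑ n ∈ Finset.range N,
    InnerProductSpace.rankOne ℂ (((U : H →L[ℂ] H) ^ n) x) (((U : H →L[ℂ] H) ^ n) x)

theorem inner_averagedRankOne (U : unitary (H →L[ℂ] H)) (x v w : H) (N : ℕ) :
    inner ℂ v (averagedRankOne U x N w) = (N : ℂ)⁻¹ * ∑ n ∈ Finset.range N,
      inner ℂ v (((U : H →L[ℂ] H) ^ n) x) * inner ℂ (((U : H →L[ℂ] H) ^ n) x) w := by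
  simp only [averagedRankOne, _root_.smul_apply, _root_.sum_apply,
    InnerProductSpace.rankOne_apply, inner_smul_right, inner_sum]
  congr 1
  exact Finset.sum_congr rfl fun n _ => mul_comm _ _

theorem inner_averagedRankOne_self (U : unitary (H →L[ℂ] H)) (x v : H) (N : ℕ) :
    inner ℂ v (averagedRankOne U x N v) =
      (((N : ℝ)⁻¹ * ∑ n ∈ Finset.range N, ‖inner ℂ v (((U : H →L[ℂ] H) ^ n) x)‖ ^ 2 : ℝ) : ℂ) := by
  rw [inner_averagedRankOne]
  push_cast
  congr 1
  refine Finset.sum_congr rfl fun n _ => ?_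
  rw [← inner_conj_symm _ v, Complex.mul_conj']

theorem inv_mul_sum_range_le {f : ℕ → ℝ} {C : ℝ} (hC : 0 ≤ C) (hf : ∀ n, f n ≤ C) (N : ℕ) :
    (N : ℝ)⁻¹ * ∑ n ∈ Finset.range N, f n ≤ C := by
  rcases N.eq_zero_or_pos with rfl | hN
  · simpa using hC
  · have : (0 : ℝ) < N := by exact_mod_cast hN
    rw [inv_mul_le_iff₀ this]
    calc _ ≤ ∑ n ∈ Finset.range N, C := Finset.sum_le_sum fun n _ => hf n
      _ = _ := by simp

theorem norm_inv_mul_sum_range_le {G : Type*} [NormedAddCommGroup G] [NormedSpace ℂ G] {f : ℕ → G}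
    {C : ℝ} (hC : 0 ≤ C) (hf : ∀ n, ‖f n‖ ≤ C) (N : ℕ) :
    ‖(N : ℂ)⁻¹ • ∑ n ∈ Finset.range N, f n‖ ≤ C := by
  rw [norm_smul, norm_inv, Complex.norm_natCast]
  exact (mul_le_mul_of_nonneg_left (norm_sum_le _ _) (by positivity)).trans
    (inv_mul_sum_range_le hC hf N)

theorem norm_averagedRankOne_le (U : unitary (H →L[ℂ] H)) (x : H) (N : ℕ) :
    ‖averagedRankOne U x N‖ ≤ ‖x‖ * ‖x‖ :=
  norm_inv_mul_sum_range_le (by positivity) (fun n => by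
    rw [InnerProductSpace.norm_rankOne, norm_pow_apply]) N

/-- Conjugation by `U` shifts the orbit of `x` by one step, which does not matter in the average. -/
theorem tendsto_inner_averagedRankOne_shift (U : unitary (H →L[ℂ] H)) (x v w : H) :
    Tendsto (fun N => inner ℂ ((U : H →L[ℂ] H) v) (averagedRankOne U x N ((U : H →L[ℂ] H) w))
      - inner ℂ v (averagedRankOne U x N w)) atTop (𝓝 0) := by
  let f : ℕ → ℂ := fun n => inner ℂ ((U : H →L[ℂ] H) v) (((U : H →L[ℂ] H) ^ n) x) *
    inner ℂ (((U : H →L[ℂ] H) ^ n) x) ((U : H →L[ℂ] H) w)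
  have hf : ∀ n, ‖f n‖ ≤ ‖v‖ * ‖x‖ * (‖x‖ * ‖w‖) := by
    intro n
    rw [norm_mul]
    gcongr
    · exact (norm_inner_le_norm _ _).trans_eq (by rw [norm_pow_apply, Unitary.norm_map])
    · exact (norm_inner_le_norm _ _).trans_eq (by rw [norm_pow_apply, Unitary.norm_map])
  have hshift : ∀ n, f (n + 1) = inner ℂ v (((U : H →L[ℂ] H) ^ n) x) *
      inner ℂ (((U : H →L[ℂ] H) ^ n) x) w := by
    intro n
    simp only [f, pow_succ', mul_apply_eq_comp, Unitary.inner_map_map]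
  have key : ∀ N, inner ℂ ((U : H →L[ℂ] H) v) (averagedRankOne U x N ((U : H →L[ℂ] H) w))
      - inner ℂ v (averagedRankOne U x N w) = (N : ℂ)⁻¹ * (f 0 - f N) := by
    intro N
    rw [inner_averagedRankOne, inner_averagedRankOne, ← mul_sub, ← Finset.sum_sub_distrib]
    congr 1
    rw [← Finset.sum_range_sub' f N]
    exact Finset.sum_congr rfl fun n _ => by rw [hshift]
  simp_rw [key]
  refine squeeze_zero_norm (a := fun N : ℕ => (N : ℝ)⁻¹ * (2 * (‖v‖ * ‖x‖ * (‖x‖ * ‖w‖))))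
    (fun N => ?_) ?_
  · rw [norm_mul, norm_inv, Complex.norm_natCast]
    gcongr
    linarith [norm_sub_le (f 0) (f N), hf 0, hf N]
  · simpa using (tendsto_inv_atTop_nhds_zero_nat (𝕜 := ℝ)).mul_const _

/-- A vector orthogonal to all the eigenvectors of `U` is weakly mixing. Any weak limit point of the
averages of the operators `|Uⁿ x⟩⟨Uⁿ x|` is a positive operator of finite trace
commuting with `U`; its quadratic form vanishes on the eigenvectors of `U`, hence it is zero. -/
theorem tendsto_average_norm_inner_sq (U : unitary (H →L[ℂ] H)) {x : H}
    (hx : ∀ z, ∀ v ∈ eigenspaceOf U z, inner ℂ v x = 0) (y : H) :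
    Tendsto (fun N : ℕ => (N : ℝ)⁻¹ * ∑ n ∈ Finset.range N,
      ‖(inner ℂ y (((U : H →L[ℂ] H) ^ n) x) : ℂ)‖ ^ 2) atTop (𝓝 0) := by
  rw [tendsto_iff_ultrafilter]
  intro u hu
  obtain ⟨K, hK⟩ := exists_weak_limit u (norm_averagedRankOne_le U x)
  have hKself : ∀ v, Tendsto (fun N : ℕ => (N : ℝ)⁻¹ * ∑ n ∈ Finset.range N,
      ‖(inner ℂ v (((U : H →L[ℂ] H) ^ n) x) : ℂ)‖ ^ 2) u (𝓝 (inner ℂ v (K v)).re) := by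
    intro v
    have := (Complex.continuous_re.tendsto _).comp (hK v v)
    refine this.congr fun N => ?_
    simp only [Function.comp_apply, inner_averagedRankOne_self, Complex.ofReal_re]
  have hKreal : ∀ v, (inner ℂ v (K v)).im = 0 := by
    intro v
    refine tendsto_nhds_unique ((Complex.continuous_im.tendsto _).comp (hK v v)) ?_
    refine tendsto_const_nhds.congr fun N => ?_
    simp only [Function.comp_apply, inner_averagedRankOne_self, Complex.ofReal_im]
  have hKpos : 0 ≤ K := by
    rw [ContinuousLinearMap.nonneg_iff_isPositive, ContinuousLinearMap.isPositive_iff_complex]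
    intro v
    have hre : 0 ≤ (inner ℂ v (K v)).re :=
      ge_of_tendsto' (hKself v) fun N => by positivity
    have hsymm : inner ℂ (K v) v = inner ℂ v (K v) := by
      rw [← inner_conj_symm, Complex.conj_eq_iff_im, hKreal]
    rw [hsymm]
    exact ⟨Complex.ext rfl (by simp [hKreal]), hre⟩
  have htrace : ∀ (n : ℕ) (v : Fin n → H), Orthonormal ℂ v →
      ∑ i, (inner ℂ (v i) (K (v i))).re ≤ ‖x‖ ^ 2 := by
    intro n v hv
    refine le_of_tendsto' (tendsto_finsetSum _ fun i _ => hKself (v i)) fun N => ?_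
    rw [← Finset.mul_sum, Finset.sum_comm]
    refine inv_mul_sum_range_le (by positivity) (fun m => ?_) N
    refine (hv.sum_inner_products_le (s := Finset.univ) (x := ((U : H →L[ℂ] H) ^ m) x)).trans_eq ?_
    rw [norm_pow_apply]
  have hUK : ∀ v w, inner ℂ ((U : H →L[ℂ] H) v) (K ((U : H →L[ℂ] H) w)) = inner ℂ v (K w) := by
    intro v w
    refine sub_eq_zero.1 (tendsto_nhds_unique ((hK _ _).sub (hK _ _)) ?_)
    exact (tendsto_inner_averagedRankOne_shift U x v w).mono_left hu
  have hcomm : Commute K (U : H →L[ℂ] H) := by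
    have h1 : star (U : H →L[ℂ] H) * (K * U) = K := by
      ext w
      refine ext_inner_left ℂ fun v => ?_
      rw [mul_apply_eq_comp, ContinuousLinearMap.star_eq_adjoint,
        ContinuousLinearMap.adjoint_inner_right]
      exact hUK v w
    have h2 := congrArg ((U : H →L[ℂ] H) * ·) h1
    simp only [← mul_assoc] at h2
    rw [Unitary.mul_star_self_of_mem U.2, one_mul] at h2
    exact h2
  have hK0 : K = 0 := by
    by_contra h0
    obtain ⟨v, μ, hv, hne⟩ := exists_eigenvector_of_trace_le hKpos h0 hcomm htrace
    apply hne
    have hvx : ∀ n, inner ℂ v (((U : H →L[ℂ] H) ^ n) x) = 0 := by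
      intro n
      induction n with
      | zero => exact hx μ v (Module.End.mem_eigenspace_iff.2 hv)
      | succ n ih =>
        rcases eq_or_ne μ 0 with rfl | hμ
        · have : v = 0 := by
            rw [← norm_eq_zero, ← Unitary.norm_map U v, hv]; simp
          simp [this]
        · have : inner ℂ ((U : H →L[ℂ] H) v) (((U : H →L[ℂ] H) ^ (n + 1)) x) = 0 := by
            rw [pow_succ', mul_apply_eq_comp, Unitary.inner_map_map, ih]
          rw [hv, inner_smul_left, mul_eq_zero] at this
          exact this.resolve_left (by simpa using hμ)
    refine tendsto_nhds_unique (hK v v) (tendsto_const_nhds.congr fun N => ?_)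
    simp_rw [inner_averagedRankOne_self, hvx]
    simp
  simpa [hK0] using hKself y

end

/-! ### Averages of products of two matrix coefficients -/

section

variable {H : Type*} [NormedAddCommGroup H] [InnerProductSpace ℂ H] [CompleteSpace H]

theorem mem_eigenspaceOf {U : unitary (H →L[ℂ] H)} {z : ℂ} {x : H} :
    x ∈ eigenspaceOf U z ↔ (U : H →L[ℂ] H) x = z • x :=
  Module.End.mem_eigenspace_iff

theorem norm_eq_one_of_mem_eigenspaceOf {U : unitary (H →L[ℂ] H)} {z : ℂ} {x : H}
    (hx : x ∈ eigenspaceOf U z) (hx0 : x ≠ 0) : ‖z‖ = 1 := by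
  have h := Unitary.norm_map U x
  rw [mem_eigenspaceOf.1 hx, norm_smul] at h
  exact mul_right_cancel₀ (norm_ne_zero_iff.2 hx0) (by rw [h, one_mul])

theorem inner_eq_zero_of_mem_eigenspaceOf {U : unitary (H →L[ℂ] H)} {z w : ℂ} (hzw : z ≠ w)
    {x y : H} (hx : x ∈ eigenspaceOf U z) (hy : y ∈ eigenspaceOf U w) : inner ℂ x y = 0 := by
  by_cases hx0 : x = 0
  · simp [hx0]
  have hz := norm_eq_one_of_mem_eigenspaceOf hx hx0
  have h := Unitary.inner_map_map U x y
  rw [mem_eigenspaceOf.1 hx, mem_eigenspaceOf.1 hy, inner_smul_left, inner_smul_right,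
    ← mul_assoc] at h
  by_contra h0
  have h1 : starRingEnd ℂ z * w = 1 := mul_right_cancel₀ h0 (by rw [h, one_mul])
  have h2 : z * starRingEnd ℂ z = 1 := by rw [Complex.mul_conj']; simp [hz]
  apply hzw
  calc z = z * (starRingEnd ℂ z * w) := by rw [h1, mul_one]
    _ = w := by rw [← mul_assoc, h2, one_mul]

theorem eigenProj_of_mem {U : unitary (H →L[ℂ] H)} {z : ℂ} {x : H} (hx : x ∈ eigenspaceOf U z) :
    eigenProj U z x = x :=
  Submodule.starProjection_eq_self_iff.2 hx

theorem eigenProj_mem (U : unitary (H →L[ℂ] H)) (z : ℂ) (x : H) :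
    eigenProj U z x ∈ eigenspaceOf U z :=
  Submodule.starProjection_apply_mem _ _

theorem norm_eigenProj_apply_le (U : unitary (H →L[ℂ] H)) (z : ℂ) (x : H) :
    ‖eigenProj U z x‖ ≤ ‖x‖ :=
  Submodule.norm_starProjection_apply_le _ _

theorem inner_eigenProj (U : unitary (H →L[ℂ] H)) (z : ℂ) (x y : H) :
    inner ℂ x (eigenProj U z y) = inner ℂ (eigenProj U z x) y :=
  (Submodule.inner_starProjection_left_eq_right _ _ _).symm

theorem inner_eigenProj_self (U : unitary (H →L[ℂ] H)) (z : ℂ) (x : H) :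
    inner ℂ x (eigenProj U z x) = (‖eigenProj U z x‖ : ℂ) ^ 2 := by
  conv_lhs => rw [← eigenProj_of_mem (eigenProj_mem U z x), inner_eigenProj]
  exact inner_self_eq_norm_sq_to_K _

theorem eigenProj_eq_zero {U : unitary (H →L[ℂ] H)} {z : ℂ} {x : H}
    (hx : ∀ v ∈ eigenspaceOf U z, inner ℂ v x = 0) : eigenProj U z x = 0 := by
  have h := hx _ (eigenProj_mem U z x)
  rw [← inner_eigenProj, inner_eigenProj_self] at h
  simpa using h

theorem orthogonalFamily_eigenspaceOf (U : unitary (H →L[ℂ] H)) {I : Type*} {g : I → ℂ}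
    (hg : Function.Injective g) :
    OrthogonalFamily ℂ (fun i => eigenspaceOf U (g i)) fun i => (eigenspaceOf U (g i)).subtypeₗᵢ :=
  fun _ _ hij v w => inner_eq_zero_of_mem_eigenspaceOf (hg.ne hij) v.2 w.2

theorem norm_sum_smul_eigenProj_sq (U : unitary (H →L[ℂ] H)) {I : Type*} {g : I → ℂ}
    (hg : Function.Injective g) (s : Finset I) (c : I → ℂ) (x : H) :
    ‖∑ i ∈ s, c i • eigenProj U (g i) x‖ ^ 2 = ∑ i ∈ s, ‖c i‖ ^ 2 * ‖eigenProj U (g i) x‖ ^ 2 := by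
  have h := (orthogonalFamily_eigenspaceOf U hg).norm_sum
    (fun i => c i • (⟨eigenProj U (g i) x, eigenProj_mem U (g i) x⟩ : eigenspaceOf U (g i))) s
  simpa [norm_smul, mul_pow] using h

/-- Bessel's inequality for the eigenspaces of `U`. -/
theorem sum_norm_sq_eigenProj_le (U : unitary (H →L[ℂ] H)) {I : Type*} {g : I → ℂ}
    (hg : Function.Injective g) (s : Finset I) (x : H) :
    ∑ i ∈ s, ‖eigenProj U (g i) x‖ ^ 2 ≤ ‖x‖ ^ 2 := by
  have h1 := norm_sum_smul_eigenProj_sq U hg s (fun _ => 1) x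
  simp only [one_smul, norm_one, one_pow, one_mul] at h1
  set S := ∑ i ∈ s, ‖eigenProj U (g i) x‖ ^ 2
  set P := ∑ i ∈ s, eigenProj U (g i) x with hP
  have h2 : inner ℂ x P = (S : ℂ) := by
    rw [hP, inner_sum]
    simp [inner_eigenProj_self, S]
  have h3 : ‖P‖ ^ 2 ≤ ‖x‖ * ‖P‖ := by
    have := norm_inner_le_norm (𝕜 := ℂ) x P
    rwa [h2, ← h1, Complex.norm_real, Real.norm_of_nonneg (by positivity)] at this
  rw [← h1]
  have h4 : ‖P‖ ≤ ‖x‖ := by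
    by_contra! h
    nlinarith [norm_nonneg x, norm_nonneg P]
  gcongr

theorem norm_sum_smul_eigenProj_le (U : unitary (H →L[ℂ] H)) {I : Type*} {g : I → ℂ}
    (hg : Function.Injective g) (s : Finset I) {c : I → ℂ} (hc : ∀ i ∈ s, ‖c i‖ ≤ 1) (x : H) :
    ‖∑ i ∈ s, c i • eigenProj U (g i) x‖ ≤ ‖x‖ := by
  refine le_of_sq_le_sq ?_ (norm_nonneg x)
  rw [norm_sum_smul_eigenProj_sq U hg]
  refine (Finset.sum_le_sum fun i hi => ?_).trans (sum_norm_sq_eigenProj_le U hg s x)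
  exact mul_le_of_le_one_left (by positivity) (pow_le_one₀ (norm_nonneg _) (hc i hi))

theorem conj_coe_injective (X : Set ℂ) :
    Function.Injective fun z : X => starRingEnd ℂ (z : ℂ) :=
  (starRingEnd ℂ).injective.comp Subtype.val_injective

/-- The time average of the product of two matrix coefficients of the powers of `U`. -/
def pairAverage (U : unitary (H →L[ℂ] H)) (y x y' x' : H) (N : ℕ) : ℂ :=
  (N : ℂ)⁻¹ * ∑ n ∈ Finset.range N,
    inner ℂ y (((U : H →L[ℂ] H) ^ n) x) * inner ℂ y' (((U : H →L[ℂ] H) ^ n) x')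

/-- The partial sums of `∑ ⟨y, E_{z̄} x⟩ ⟨y', E_z x'⟩`, which is the limit of the time averages
`pairAverage U y x y' x'`. -/
def pairSum (U : unitary (H →L[ℂ] H)) (y x y' x' : H) (F : Finset (antidiagonalSpectrum U)) : ℂ :=
  ∑ z ∈ F, inner ℂ y (eigenProj U (starRingEnd ℂ (z : ℂ)) x) * inner ℂ y' (eigenProj U z x')

/-- The partial sums of the vectors `⟨y', E_z x'⟩ E_{z̄} x`. -/
def pairVector (U : unitary (H →L[ℂ] H)) (x y' x' : H) (F : Finset (antidiagonalSpectrum U)) : H :=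
  ∑ z ∈ F, (inner ℂ y' (eigenProj U z x') : ℂ) • eigenProj U (starRingEnd ℂ (z : ℂ)) x

theorem inner_pairVector (U : unitary (H →L[ℂ] H)) (y x y' x' : H)
    (F : Finset (antidiagonalSpectrum U)) :
    inner ℂ y (pairVector U x y' x' F) = pairSum U y x y' x' F := by
  simp only [pairVector, pairSum, inner_sum, inner_smul_right]
  exact Finset.sum_congr rfl fun z _ => mul_comm _ _

theorem exists_tendsto_pairVector (U : unitary (H →L[ℂ] H)) (x y' x' : H) :
    ∃ v, Tendsto (pairVector U x y' x') atTop (𝓝 v) := by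
  have hg := conj_coe_injective (antidiagonalSpectrum U)
  have hs := (orthogonalFamily_eigenspaceOf U hg).summable_iff_norm_sq_summable
    (fun z => (inner ℂ y' (eigenProj U z x') : ℂ) •
      (⟨eigenProj U (starRingEnd ℂ (z : ℂ)) x, eigenProj_mem U _ x⟩ :
        eigenspaceOf U (starRingEnd ℂ (z : ℂ))))
  obtain ⟨v, hv⟩ := hs.2 (summable_of_sum_le (c := (‖y'‖ * ‖x'‖) ^ 2 * ‖x‖ ^ 2)
    (fun z => by positivity) fun F => by
      refine le_trans (Finset.sum_le_sum fun z _ => ?_) (le_of_eq_of_le (Finset.mul_sum _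
        (fun z : antidiagonalSpectrum U => ‖eigenProj U (starRingEnd ℂ (z : ℂ)) x‖ ^ 2) _).symm
          (mul_le_mul_of_nonneg_left (sum_norm_sq_eigenProj_le U hg F x) (by positivity)))
      rw [norm_smul, mul_pow]
      gcongr
      · exact (norm_inner_le_norm _ _).trans (by gcongr; exact norm_eigenProj_apply_le U _ _)
      · rfl)
  rw [HasSum, SummationFilter.unconditional_filter] at hv
  exact ⟨v, hv⟩

theorem exists_tendsto_pairSum (U : unitary (H →L[ℂ] H)) (y x y' x' : H) :
    ∃ c, Tendsto (pairSum U y x y' x') atTop (𝓝 c) := by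
  obtain ⟨v, hv⟩ := exists_tendsto_pairVector U x y' x'
  exact ⟨inner ℂ y v, (tendsto_const_nhds.inner hv).congr fun F => inner_pairVector U y x y' x' F⟩

theorem norm_pairAverage_le (U : unitary (H →L[ℂ] H)) (y x y' x' : H) (N : ℕ) :
    ‖pairAverage U y x y' x' N‖ ≤ ‖y‖ * ‖x‖ * (‖y'‖ * ‖x'‖) := by
  refine norm_inv_mul_sum_range_le (by positivity) (fun n => ?_) N
  rw [norm_mul]
  gcongr
  · exact (norm_inner_le_norm _ _).trans_eq (by rw [norm_pow_apply])
  · exact (norm_inner_le_norm _ _).trans_eq (by rw [norm_pow_apply])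

theorem norm_pairSum_le (U : unitary (H →L[ℂ] H)) (y x y' x' : H)
    (F : Finset (antidiagonalSpectrum U)) :
    ‖pairSum U y x y' x' F‖ ≤ ‖y‖ * ‖x‖ * (‖y'‖ * ‖x'‖) := by
  have hg := conj_coe_injective (antidiagonalSpectrum U)
  calc ‖pairSum U y x y' x' F‖
      ≤ ∑ z ∈ F, ‖y‖ * ‖y'‖ *
          (‖eigenProj U (starRingEnd ℂ (z : ℂ)) x‖ * ‖eigenProj U (z : ℂ) x'‖) := by
        refine norm_sum_le_of_le _ fun z _ => ?_
        rw [norm_mul]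
        refine (mul_le_mul (norm_inner_le_norm _ _) (norm_inner_le_norm _ _) (norm_nonneg _)
          (by positivity)).trans_eq (by ring)
    _ = ‖y‖ * ‖y'‖ * ∑ z ∈ F,
          ‖eigenProj U (starRingEnd ℂ (z : ℂ)) x‖ * ‖eigenProj U (z : ℂ) x'‖ := by
        rw [Finset.mul_sum]
    _ ≤ ‖y‖ * ‖y'‖ * (√(‖x‖ ^ 2) * √(‖x'‖ ^ 2)) := by
        gcongr
        refine (Real.sum_mul_le_sqrt_mul_sqrt _ _ _).trans ?_
        gcongr
        · exact sum_norm_sq_eigenProj_le U hg F x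
        · exact sum_norm_sq_eigenProj_le U Subtype.val_injective F x'
    _ = ‖y‖ * ‖x‖ * (‖y'‖ * ‖x'‖) := by
        rw [Real.sqrt_sq (norm_nonneg _), Real.sqrt_sq (norm_nonneg _)]
        ring

/-- The mean ergodic theorem for `w U`. -/
theorem tendsto_average_pow_mul (U : unitary (H →L[ℂ] H)) {w : ℂ} (hw : ‖w‖ = 1) (x : H) :
    Tendsto (fun N : ℕ => (N : ℂ)⁻¹ • ∑ n ∈ Finset.range N, w ^ n • ((U : H →L[ℂ] H) ^ n) x) atTop
      (𝓝 (eigenProj U (starRingEnd ℂ w) x)) := by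
  have hww : starRingEnd ℂ w * w = 1 := by rw [Complex.conj_mul']; simp [hw]
  have hnorm : ‖w • (U : H →L[ℂ] H)‖ ≤ 1 :=
    ContinuousLinearMap.opNorm_le_bound _ zero_le_one fun x => by
      simp [norm_smul, hw, Unitary.norm_map]
  have h := (w • (U : H →L[ℂ] H)).tendsto_birkhoffAverage_orthogonalProjection hnorm x
  have hspace : ((w • (U : H →L[ℂ] H)).eqLocus (1 : H →L[ℂ] H)) =
      eigenspaceOf U (starRingEnd ℂ w) := by
    ext v
    rw [mem_eigenspaceOf]
    change w • (U : H →L[ℂ] H) v = v ↔ _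
    constructor
    · intro hv
      conv_rhs => rw [← hv, smul_smul, hww, one_smul]
    · intro hv
      rw [hv, smul_smul, mul_comm, hww, one_smul]
  have hproj : (((w • (U : H →L[ℂ] H)).eqLocus (1 : H →L[ℂ] H)).orthogonalProjectionOnto x : H) =
      eigenProj U (starRingEnd ℂ w) x := by
    refine (Submodule.eq_starProjection_of_mem_of_inner_eq_zero (hspace ▸ eigenProj_mem U _ x)
      fun v hv => ?_)
    rw [hspace] at hv
    exact Submodule.starProjection_inner_eq_zero _ _ hv
  rw [hproj] at h
  refine h.congr fun N => ?_
  simp only [birkhoffAverage, birkhoffSum, id]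
  congr 1
  refine Finset.sum_congr rfl fun n _ => ?_
  rw [← FunLike.coe_pow_eq_iterate, smul_pow]
  rfl

theorem tendsto_pairAverage_sub_pairSum_of_mem_eigenspaceOf (U : unitary (H →L[ℂ] H))
    (y x y' : H) {x' : H} {w : ℂ} (hx' : x' ∈ eigenspaceOf U w) :
    Tendsto (fun p : ℕ × Finset (antidiagonalSpectrum U) =>
      pairAverage U y x y' x' p.1 - pairSum U y x y' x' p.2) (atTop ×ˢ atTop) (𝓝 0) := by
  by_cases hx0 : x' = 0
  · simp [pairAverage, pairSum, hx0]
  have hw := norm_eq_one_of_mem_eigenspaceOf hx' hx0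
  have hww : w * starRingEnd ℂ w = 1 := by rw [Complex.mul_conj']; simp [hw]
  set c : ℂ := inner ℂ y (eigenProj U (starRingEnd ℂ w) x) * inner ℂ y' x' with hc
  have hpow : ∀ n : ℕ, ((U : H →L[ℂ] H) ^ n) x' = w ^ n • x' := by
    intro n
    induction n with
    | zero => simp
    | succ n ih =>
      rw [pow_succ', mul_apply_eq_comp, ih, map_smul, mem_eigenspaceOf.1 hx', smul_smul, pow_succ]
  have havg : Tendsto (pairAverage U y x y' x') atTop (𝓝 c) := by
    have h1 : Tendsto _ atTop (𝓝 c) :=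
      ((tendsto_const_nhds (x := y)).inner (𝕜 := ℂ) (tendsto_average_pow_mul U hw x)).mul_const
        (inner ℂ y' x')
    refine h1.congr fun N => ?_
    simp only [pairAverage, inner_smul_right, inner_sum, hpow, mul_assoc, Finset.sum_mul]
    congr 1
    exact Finset.sum_congr rfl fun n _ => by ring
  have hproj : ∀ z : ℂ, z ≠ w → eigenProj U z x' = 0 := fun z hz =>
    eigenProj_eq_zero fun v hv => inner_eq_zero_of_mem_eigenspaceOf hz hv hx'
  -- for `w` outside of the antidiagonal spectrum both sides vanish: `w̄ = w⁻¹` is no eigenvalue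
  have hsum : ∀ᶠ F in atTop, pairSum U y x y' x' F = c := by
    by_cases hmem : w ∈ antidiagonalSpectrum U
    · filter_upwards [eventually_ge_atTop {(⟨w, hmem⟩ : antidiagonalSpectrum U)}] with F hF
      rw [pairSum, Finset.sum_eq_single (⟨w, hmem⟩ : antidiagonalSpectrum U)]
      · rw [eigenProj_of_mem hx']
      · intro z _ hz
        rw [hproj z fun h => hz (Subtype.ext h)]
        simp
      · exact fun h => absurd (hF (Finset.mem_singleton_self _)) h
    · have hzero : eigenProj U (starRingEnd ℂ w) x = 0 := by
        by_contra h0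
        exact hmem ⟨Module.End.hasEigenvalue_of_hasEigenvector ⟨hx', hx0⟩, starRingEnd ℂ w,
          Module.End.hasEigenvalue_of_hasEigenvector ⟨eigenProj_mem U _ x, h0⟩, hww⟩
      refine Eventually.of_forall fun F => ?_
      rw [hc, hzero, inner_zero_right, zero_mul]
      refine Finset.sum_eq_zero fun z _ => ?_
      rw [hproj z fun h => hmem (h ▸ z.2)]
      simp
  have hsum' : Tendsto (pairSum U y x y' x') atTop (𝓝 c) :=
    tendsto_const_nhds.congr' (hsum.mono fun _ h => h.symm)
  simpa using (havg.comp tendsto_fst).sub (hsum'.comp tendsto_snd)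

theorem tendsto_pairAverage_of_orthogonal (U : unitary (H →L[ℂ] H)) (y x y' : H) {x' : H}
    (hx' : ∀ z, ∀ v ∈ eigenspaceOf U z, inner ℂ v x' = 0) :
    Tendsto (pairAverage U y x y' x') atTop (𝓝 0) := by
  have h := (tendsto_average_norm_inner_sq U hx' y').sqrt.const_mul (‖y‖ * ‖x‖)
  rw [Real.sqrt_zero, mul_zero] at h
  refine squeeze_zero_norm (fun N => ?_) h
  rcases N.eq_zero_or_pos with rfl | hN
  · simp [pairAverage]
  have hN' : (0 : ℝ) < N := by exact_mod_cast hN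
  rw [pairAverage, norm_mul, norm_inv, Complex.norm_natCast]
  set f : ℕ → ℝ := fun n => ‖(inner ℂ y' (((U : H →L[ℂ] H) ^ n) x') : ℂ)‖
  have h1 : ‖∑ n ∈ Finset.range N, inner ℂ y (((U : H →L[ℂ] H) ^ n) x) *
      inner ℂ y' (((U : H →L[ℂ] H) ^ n) x')‖ ≤ ‖y‖ * ‖x‖ * ∑ n ∈ Finset.range N, f n := by
    rw [Finset.mul_sum]
    refine norm_sum_le_of_le _ fun n _ => ?_
    rw [norm_mul]
    gcongr
    exact (norm_inner_le_norm _ _).trans_eq (by rw [norm_pow_apply])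
  have h2 : (N : ℝ)⁻¹ * ∑ n ∈ Finset.range N, f n ≤
      √((N : ℝ)⁻¹ * ∑ n ∈ Finset.range N, f n ^ 2) := by
    refine Real.le_sqrt_of_sq_le ?_
    have := sq_sum_le_card_mul_sum_sq (s := Finset.range N) (f := f)
    rw [Finset.card_range] at this
    calc _ = (N : ℝ)⁻¹ * (N : ℝ)⁻¹ * (∑ n ∈ Finset.range N, f n) ^ 2 := by ring
      _ ≤ (N : ℝ)⁻¹ * (N : ℝ)⁻¹ * (N * ∑ n ∈ Finset.range N, f n ^ 2) := by gcongr
      _ = _ := by field_simp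
  calc _ ≤ (N : ℝ)⁻¹ * (‖y‖ * ‖x‖ * ∑ n ∈ Finset.range N, f n) := by gcongr
    _ = ‖y‖ * ‖x‖ * ((N : ℝ)⁻¹ * ∑ n ∈ Finset.range N, f n) := by ring
    _ ≤ _ := by gcongr

/-- By linearity and density it suffices to let `x'` be an eigenvector of `U`, where the mean
ergodic theorem applies, or a vector orthogonal to all the eigenvectors, which is weakly mixing. -/
theorem tendsto_pairAverage_sub_pairSum (U : unitary (H →L[ℂ] H)) (y x y' x' : H) :
    Tendsto (fun p : ℕ × Finset (antidiagonalSpectrum U) =>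
      pairAverage U y x y' x' p.1 - pairSum U y x y' x' p.2) (atTop ×ˢ atTop) (𝓝 0) := by
  let φ : ℕ × Finset (antidiagonalSpectrum U) → H →ₗ[ℂ] ℂ := fun p =>
    { toFun := fun x' => pairAverage U y x y' x' p.1 - pairSum U y x y' x' p.2
      map_add' := fun v w => by
        simp only [pairAverage, pairSum, map_add, inner_add_right, mul_add,
          Finset.sum_add_distrib]
        ring
      map_smul' := fun c v => by
        simp only [pairAverage, pairSum, map_smul, inner_smul_right, RingHom.id_apply, smul_eq_mul,
          mul_left_comm _ c, ← Finset.mul_sum, mul_sub] }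
  let D : Set H := {v | (∃ z, v ∈ eigenspaceOf U z) ∨ ∀ z, ∀ w ∈ eigenspaceOf U z, inner ℂ w v = 0}
  have hD : ∀ v ∈ D, Tendsto (fun p => φ p v) (atTop ×ˢ atTop) (𝓝 0) := by
    rintro v (⟨z, hz⟩ | hv)
    · exact tendsto_pairAverage_sub_pairSum_of_mem_eigenspaceOf U y x y' hz
    · have h0 : ∀ F, pairSum U y x y' v F = 0 := fun F =>
        Finset.sum_eq_zero fun z _ => by rw [eigenProj_eq_zero (hv z)]; simp
      simpa [φ, h0, Function.comp_def] using (tendsto_pairAverage_of_orthogonal U y x y' hv).comp tendsto_fst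
  have hφ : ∀ p v, ‖φ p v‖ ≤ 2 * (‖y‖ * ‖x‖ * ‖y'‖) * ‖v‖ := fun p v =>
    (norm_sub_le _ _).trans (by
      linarith [norm_pairAverage_le U y x y' v p.1, norm_pairSum_le U y x y' v p.2])
  refine tendsto_zero_of_mem_closure_span hφ hD (v := x') ?_
  let W : Submodule ℂ H := (⨆ z, eigenspaceOf U z).topologicalClosure
  have : CompleteSpace W := (Submodule.isClosed_topologicalClosure _).completeSpace_coe
  have hWle : W ≤ (Submodule.span ℂ D).topologicalClosure :=
    Submodule.topologicalClosure_mono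
      (iSup_le fun z v hv => Submodule.subset_span (Or.inl ⟨z, hv⟩))
  rw [← Submodule.topologicalClosure_coe, SetLike.mem_coe,
    ← add_sub_cancel (W.starProjection x') x']
  refine add_mem (hWle (Submodule.starProjection_apply_mem _ _))
    (Submodule.le_topologicalClosure _ (Submodule.subset_span (Or.inr fun z v hv => ?_)))
  rw [← inner_conj_symm, Submodule.starProjection_inner_eq_zero _ _
    (Submodule.le_topologicalClosure _ (Submodule.mem_iSup_of_mem z hv)), map_zero]

end

/-! ### Entangled words in compact operators -/

section

/-- The fibres of `α` are the pairs `{s j, t j}`, where `s j < t j`. -/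
structure HasPairs {n k : ℕ} (α : Fin n → Fin k) (s t : Fin k → Fin n) : Prop where
  lt : ∀ j, s j < t j
  apply_eq_iff : ∀ i j, α i = j ↔ i = s j ∨ i = t j

theorem IsPairPartition.exists_hasPairs {k : ℕ} {α : Fin (2 * k) → Fin k}
    (hα : IsPairPartition α) : ∃ s t : Fin k → Fin (2 * k), HasPairs α s t := by
  have h : ∀ j, ∃ a b : Fin (2 * k), a < b ∧ (Finset.univ.filter fun i => α i = j) = {a, b} := by
    intro j
    obtain ⟨a, b, hab, h⟩ := Finset.card_eq_two.1 (hα j)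
    rcases lt_or_gt_of_ne hab with hlt | hlt
    · exact ⟨a, b, hlt, h⟩
    · exact ⟨b, a, hlt, h.trans (Finset.pair_comm a b)⟩
  choose s t hst h using h
  exact ⟨s, t, hst, fun i j => by simpa using Finset.ext_iff.1 (h j) i⟩

namespace HasPairs

variable {n k : ℕ} {α : Fin n → Fin k} {s t : Fin k → Fin n}

theorem apply_fst (h : HasPairs α s t) (j : Fin k) : α (s j) = j :=
  (h.apply_eq_iff _ _).2 (Or.inl rfl)

theorem apply_snd (h : HasPairs α s t) (j : Fin k) : α (t j) = j :=
  (h.apply_eq_iff _ _).2 (Or.inr rfl)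

@[to_additive]
theorem prod_eq (h : HasPairs α s t) {M : Type*} [CommMonoid M] (f : Fin n → M) :
    ∏ i, f i = ∏ j, f (s j) * f (t j) := by
  rw [← Finset.prod_fiberwise Finset.univ α f]
  refine Finset.prod_congr rfl fun j _ => ?_
  have : (Finset.univ.filter fun i => α i = j) = {s j, t j} := by
    ext i
    simpa using h.apply_eq_iff i j
  rw [this, Finset.prod_pair (h.lt j).ne]

end HasPairs

theorem alternating_fst {k : ℕ} {α : Fin (2 * k) → Fin k} {s t : Fin k → Fin (2 * k)}
    (h : HasPairs α s t) (z : Fin k → ℂ) (j : Fin k) :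
    alternating α z (s j) = starRingEnd ℂ (z j) := by
  rw [alternating, if_neg, h.apply_fst]
  rintro ⟨l, hl, hα⟩
  rw [h.apply_fst, h.apply_eq_iff] at hα
  rcases hα with rfl | rfl
  · exact lt_irrefl _ hl
  · exact lt_asymm hl (h.lt j)

theorem alternating_snd {k : ℕ} {α : Fin (2 * k) → Fin k} {s t : Fin k → Fin (2 * k)}
    (h : HasPairs α s t) (z : Fin k → ℂ) (j : Fin k) : alternating α z (t j) = z j := by
  rw [alternating, if_pos ⟨s j, h.lt j, by rw [h.apply_fst, h.apply_snd]⟩, h.apply_snd]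

section Word

variable {H : Type*} [NormedAddCommGroup H] [InnerProductSpace ℂ H]

/-- The product `E_1 A_1 E_2 A_2 ⋯ E_n A_n`, as a multilinear map in the `A_i`. Unlike in
`interlace`, there is an operator after the last `E_n`. -/
def word {n : ℕ} (E : Fin n → H →L[ℂ] H) :
    MultilinearMap ℂ (fun _ : Fin n => H →L[ℂ] H) (H →L[ℂ] H) :=
  (MultilinearMap.mkPiAlgebraFin ℂ n (H →L[ℂ] H)).compLinearMap fun i => LinearMap.mulLeft ℂ (E i)

theorem word_apply {n : ℕ} (E A : Fin n → H →L[ℂ] H) :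
    word E A = (List.ofFn fun i => E i * A i).prod := by
  simp [word]

theorem norm_word_le {n : ℕ} {E : Fin n → H →L[ℂ] H} (hE : ∀ i, ‖E i‖ ≤ 1)
    (A : Fin n → H →L[ℂ] H) : ‖word E A‖ ≤ ∏ i, ‖A i‖ := by
  rw [word_apply]
  induction n with
  | zero => exact (ContinuousLinearMap.norm_id_le (𝕜 := ℂ) (E := H)).trans_eq (by simp)
  | succ n ih =>
    rw [List.ofFn_succ, List.prod_cons, Fin.prod_univ_succ]
    refine (norm_mul_le _ _).trans (mul_le_mul ?_ (ih (fun i => hE i.succ) fun i => A i.succ)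
      (norm_nonneg _) (norm_nonneg _))
    exact (norm_mul_le _ _).trans (mul_le_of_le_one_left (norm_nonneg _) (hE 0))

theorem word_sum_smul {n : ℕ} {I : Type*} [Fintype I] (c : Fin n → I → ℂ)
    (E : Fin n → I → H →L[ℂ] H) (A : Fin n → H →L[ℂ] H) :
    word (fun i => ∑ a, c i a • E i a) A =
      ∑ w : Fin n → I, (∏ i, c i (w i)) • word (fun i => E i (w i)) A := by
  let φ := (MultilinearMap.mkPiAlgebraFin ℂ n (H →L[ℂ] H)).compLinearMap
    fun i => LinearMap.mulRight ℂ (A i)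
  have hφ : ∀ E, word E A = φ E := fun E => by simp [word, φ]
  simp_rw [hφ, MultilinearMap.map_sum, MultilinearMap.map_smul_univ φ]

theorem inner_word_rankOne {n : ℕ} (E : Fin n → H →L[ℂ] H) (x y : Fin n → H) (u w : H) :
    inner ℂ u (word E (fun i => InnerProductSpace.rankOne ℂ (x i) (y i)) w) =
      (∏ i, inner ℂ ((Fin.cons u y : Fin (n + 1) → H) i.castSucc) (E i (x i))) *
        inner ℂ ((Fin.cons u y : Fin (n + 1) → H) (Fin.last n)) w := by
  rw [word_apply]
  induction n generalizing u with
  | zero => simp [one_apply_eq_self]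
  | succ n ih =>
    have h := ih (fun i => E i.succ) (fun i => x i.succ) (fun i => y i.succ) (y 0)
    have hy : (Fin.cons (y 0) (fun i : Fin n => y i.succ) : Fin (n + 1) → H) = y :=
      Fin.cons_self_tail y
    rw [hy] at h
    rw [List.ofFn_succ, List.prod_cons, mul_apply_eq_comp, mul_apply_eq_comp,
      InnerProductSpace.rankOne_apply, map_smul, inner_smul_right, h, Fin.prod_univ_succ,
      ← Fin.succ_last, Fin.cons_succ, Fin.castSucc_zero, Fin.cons_zero]
    simp_rw [← Fin.succ_castSucc, Fin.cons_succ]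
    ring

section Signs

theorem sum_sign_mul_sign {I : Type*} [Fintype I] [DecidableEq I] (a b : I) :
    ∑ ε : I → ℤˣ, (((ε a : ℤˣ) : ℤ) : ℂ) * (((ε b : ℤˣ) : ℤ) : ℂ) =
      if a = b then (Fintype.card (I → ℤˣ) : ℂ) else 0 := by
  split_ifs with hab
  · subst hab
    have : ∀ ε : I → ℤˣ, (((ε a : ℤˣ) : ℤ) : ℂ) * (((ε a : ℤˣ) : ℤ) : ℂ) = 1 := fun ε => by
      rw [← Int.cast_mul, ← Units.val_mul, ← sq, Int.units_sq]; simp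
    simp [this]
  · -- flipping the sign at `a` changes the sign of the sum
    have h := Equiv.sum_comp (Equiv.mulRight (Pi.mulSingle a (-1 : ℤˣ)))
      fun ε : I → ℤˣ => (((ε a : ℤˣ) : ℤ) : ℂ) * (((ε b : ℤˣ) : ℤ) : ℂ)
    simp only [Equiv.coe_mulRight, Pi.mul_apply, Pi.mulSingle_eq_same,
      Pi.mulSingle_eq_of_ne (Ne.symm hab), mul_one, mul_neg, Units.val_neg, Int.cast_neg, neg_mul,
      Finset.sum_neg_distrib] at h
    linear_combination -(1 / 2 : ℂ) * h

variable {n k : ℕ} {α : Fin n → Fin k} {s t : Fin k → Fin n}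

/-- An entangled sum is an average of words over independent random signs: only the terms in which
the two positions of each pair carry the same index survive. -/
theorem sum_word_eq_sum_signs (h : HasPairs α s t) {I : Type*} [Fintype I] [DecidableEq I]
    (E : Fin n → I → H →L[ℂ] H) (A : Fin n → H →L[ℂ] H) :
    ((Fintype.card (I → ℤˣ) : ℂ) ^ k) • ∑ z : Fin k → I, word (fun i => E i (z (α i))) A =
      ∑ ε : Fin k → I → ℤˣ, word (fun i => ∑ a, (((ε (α i) a : ℤˣ) : ℤ) : ℂ) • E i a) A := by
  simp_rw [word_sum_smul]
  rw [Finset.sum_comm]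
  simp_rw [← Finset.sum_smul]
  have hw : ∀ w : Fin n → I, ∑ ε : Fin k → I → ℤˣ, ∏ i, (((ε (α i) (w i) : ℤˣ) : ℤ) : ℂ) =
      if ∀ j, w (s j) = w (t j) then (Fintype.card (I → ℤˣ) : ℂ) ^ k else 0 := by
    intro w
    simp_rw [h.prod_eq, h.apply_fst, h.apply_snd]
    rw [← Fintype.prod_sum fun (j : Fin k) (e : I → ℤˣ) =>
      (((e (w (s j)) : ℤˣ) : ℤ) : ℂ) * (((e (w (t j)) : ℤˣ) : ℤ) : ℂ)]
    simp_rw [sum_sign_mul_sign, Fintype.prod_ite_zero]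
    simp
  simp_rw [hw, ite_smul, zero_smul]
  rw [← Finset.sum_filter, Finset.smul_sum]
  refine Finset.sum_bij (fun z _ i => z (α i)) (fun z _ => ?_) (fun z _ z' _ hz => ?_)
    (fun w hw => ?_) (fun z _ => rfl)
  · simp [h.apply_fst, h.apply_snd]
  · funext j
    simpa [h.apply_fst] using congrFun hz (s j)
  · refine ⟨fun j => w (s j), Finset.mem_univ _, ?_⟩
    funext i
    rcases (h.apply_eq_iff i _).1 rfl with hi | hi
    · exact congrArg w hi.symm
    · exact ((Finset.mem_filter.1 hw).2 _).trans (congrArg w hi.symm)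

theorem norm_sum_word_le (h : HasPairs α s t) {I : Type*} [Fintype I] [DecidableEq I]
    (E : Fin n → I → H →L[ℂ] H)
    (hE : ∀ (i : Fin n) (ε : I → ℤˣ), ‖∑ a, (((ε a : ℤˣ) : ℤ) : ℂ) • E i a‖ ≤ 1)
    (A : Fin n → H →L[ℂ] H) :
    ‖∑ z : Fin k → I, word (fun i => E i (z (α i))) A‖ ≤ ∏ i, ‖A i‖ := by
  have hM : (0 : ℝ) < (Fintype.card (I → ℤˣ) : ℝ) ^ k := by
    have : 0 < Fintype.card (I → ℤˣ) := Fintype.card_pos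
    positivity
  refine le_of_mul_le_mul_left ?_ hM
  calc _ = ‖((Fintype.card (I → ℤˣ) : ℂ) ^ k) • ∑ z : Fin k → I, word (fun i => E i (z (α i))) A‖ := by
        rw [norm_smul, norm_pow, Complex.norm_natCast]
    _ ≤ ∑ ε : Fin k → I → ℤˣ, ∏ i, ‖A i‖ := by
        rw [sum_word_eq_sum_signs h]
        exact norm_sum_le_of_le _ fun ε _ => norm_word_le (fun i => hE i _) A
    _ = _ := by
        rw [Finset.sum_const, Finset.card_univ, Fintype.card_fun, Fintype.card_fin, nsmul_eq_mul,
          Nat.cast_pow]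

end Signs

end Word

variable {H : Type*} [NormedAddCommGroup H] [InnerProductSpace ℂ H] [CompleteSpace H]

section Entangled

variable {k : ℕ} {α : Fin (2 * k) → Fin k} {s t : Fin k → Fin (2 * k)}

/-- The operator `S^F`, with an additional operator after the last projection. -/
def entangledWord (U : unitary (H →L[ℂ] H)) (α : Fin (2 * k) → Fin k)
    (F : Finset (antidiagonalSpectrum U)) :
    MultilinearMap ℂ (fun _ : Fin (2 * k) => H →L[ℂ] H) (H →L[ℂ] H) :=
  ∑ z ∈ Fintype.piFinset (fun _ : Fin k => F),
    word fun i => eigenProj U (alternating α (fun j => (z j : ℂ)) i)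

/-- The time averages of `U^{n_α(1)} A_1 ⋯ U^{n_α(2k)} A_{2k}`. -/
def averagedWord (U : unitary (H →L[ℂ] H)) (α : Fin (2 * k) → Fin k) (N : ℕ) :
    MultilinearMap ℂ (fun _ : Fin (2 * k) => H →L[ℂ] H) (H →L[ℂ] H) :=
  ((N : ℂ) ^ k)⁻¹ • ∑ n ∈ Fintype.piFinset (fun _ : Fin k => Finset.range N),
    word fun i => (U : H →L[ℂ] H) ^ n (α i)

/-- A bound uniform in `F`: the operators `∑_{z ∈ F} ± E_{z^#}` are contractions. -/
theorem norm_entangledWord_le (h : HasPairs α s t) (U : unitary (H →L[ℂ] H))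
    (F : Finset (antidiagonalSpectrum U)) (A : Fin (2 * k) → H →L[ℂ] H) :
    ‖entangledWord U α F A‖ ≤ ∏ i, ‖A i‖ := by
  classical
  let E : Fin (2 * k) → F → H →L[ℂ] H := fun i a =>
    eigenProj U (if ∃ l, l < i ∧ α l = α i then (a : ℂ) else starRingEnd ℂ (a : ℂ))
  have heq : entangledWord U α F A = ∑ z : Fin k → F, word (fun i => E i (z (α i))) A := by
    rw [entangledWord, _root_.sum_apply]
    symm
    refine Finset.sum_bij (fun z _ j => (z j : antidiagonalSpectrum U)) (fun z _ => ?_)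
      (fun z _ z' _ hz => ?_) (fun w hw => ?_) (fun z _ => rfl)
    · simp
    · funext j
      exact Subtype.ext (congrFun hz j)
    · exact ⟨fun j => ⟨w j, Fintype.mem_piFinset.1 hw j⟩, Finset.mem_univ _, rfl⟩
  rw [heq]
  refine norm_sum_word_le h E (fun i ε => ?_) A
  refine ContinuousLinearMap.opNorm_le_bound _ zero_le_one fun x => ?_
  rw [one_mul, _root_.sum_apply]
  have hinj : Function.Injective fun a : F =>
      if ∃ l, l < i ∧ α l = α i then ((a : antidiagonalSpectrum U) : ℂ)
        else starRingEnd ℂ ((a : antidiagonalSpectrum U) : ℂ) := by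
    split_ifs
    · exact Subtype.val_injective.comp Subtype.val_injective
    · exact (conj_coe_injective _).comp Subtype.val_injective
  refine norm_sum_smul_eigenProj_le U hinj Finset.univ (fun a _ => ?_) x
  rcases Int.units_eq_one_or (ε a) with h1 | h1 <;> simp [h1]

theorem norm_unitary_pow_le (U : unitary (H →L[ℂ] H)) (n : ℕ) : ‖(U : H →L[ℂ] H) ^ n‖ ≤ 1 :=
  ContinuousLinearMap.opNorm_le_bound _ zero_le_one fun x => by rw [norm_pow_apply, one_mul]

theorem norm_inv_pow_smul_sum_le {G : Type*} [NormedAddCommGroup G] [NormedSpace ℂ G]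
    {f : (Fin k → ℕ) → G} {C : ℝ} (hC : 0 ≤ C) (hf : ∀ n, ‖f n‖ ≤ C) (N : ℕ) :
    ‖((N : ℂ) ^ k)⁻¹ • ∑ n ∈ Fintype.piFinset (fun _ : Fin k => Finset.range N), f n‖ ≤ C := by
  have h1 := norm_sum_le_of_le (Fintype.piFinset fun _ : Fin k => Finset.range N)
    fun n _ => hf n
  rw [Finset.sum_const, Fintype.card_piFinset_const, Finset.card_range, nsmul_eq_mul,
    Nat.cast_pow] at h1
  rw [norm_smul, norm_inv, norm_pow, Complex.norm_natCast]
  calc _ ≤ ((N : ℝ) ^ k)⁻¹ * ((N : ℝ) ^ k * C) := by gcongr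
    _ = (((N : ℝ) ^ k)⁻¹ * (N : ℝ) ^ k) * C := by ring
    _ ≤ 1 * C := by gcongr; exact inv_mul_le_one
    _ = C := one_mul C

theorem norm_averagedWord_le (U : unitary (H →L[ℂ] H)) (N : ℕ) (A : Fin (2 * k) → H →L[ℂ] H) :
    ‖averagedWord U α N A‖ ≤ ∏ i, ‖A i‖ := by
  rw [averagedWord, _root_.smul_apply, _root_.sum_apply]
  exact norm_inv_pow_smul_sum_le (by positivity)
    (fun n => norm_word_le (fun i => norm_unitary_pow_le U _) A) N

/-- On operators of rank one, the sum over `z_1, …, z_k` factorizes over the pairs. -/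
theorem inner_entangledWord_rankOne (h : HasPairs α s t) (U : unitary (H →L[ℂ] H))
    (F : Finset (antidiagonalSpectrum U)) (x y : Fin (2 * k) → H) (u w : H) :
    inner ℂ u (entangledWord U α F (fun i => InnerProductSpace.rankOne ℂ (x i) (y i)) w) =
      (∏ j, pairSum U ((Fin.cons u y : Fin (2 * k + 1) → H) (s j).castSucc) (x (s j))
        ((Fin.cons u y : Fin (2 * k + 1) → H) (t j).castSucc) (x (t j)) F) *
        inner ℂ ((Fin.cons u y : Fin (2 * k + 1) → H) (Fin.last _)) w := by
  simp only [entangledWord, _root_.sum_apply, inner_sum,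
    inner_word_rankOne, ← Finset.sum_mul]
  congr 1
  simp_rw [pairSum]
  rw [Finset.prod_univ_sum]
  refine Finset.sum_congr rfl fun z _ => ?_
  simp_rw [h.prod_eq, alternating_fst h, alternating_snd h]

/-- On operators of rank one, the average over `n_1, …, n_k` factorizes over the pairs. -/
theorem inner_averagedWord_rankOne (h : HasPairs α s t) (U : unitary (H →L[ℂ] H))
    (N : ℕ) (x y : Fin (2 * k) → H) (u w : H) :
    inner ℂ u (averagedWord U α N (fun i => InnerProductSpace.rankOne ℂ (x i) (y i)) w) =
      (∏ j, pairAverage U ((Fin.cons u y : Fin (2 * k + 1) → H) (s j).castSucc) (x (s j))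
        ((Fin.cons u y : Fin (2 * k + 1) → H) (t j).castSucc) (x (t j)) N) *
        inner ℂ ((Fin.cons u y : Fin (2 * k + 1) → H) (Fin.last _)) w := by
  simp only [averagedWord, _root_.smul_apply, _root_.sum_apply,
    inner_smul_right, inner_sum, inner_word_rankOne, ← Finset.sum_mul, ← mul_assoc]
  congr 1
  simp_rw [pairAverage]
  rw [Finset.prod_mul_distrib, Finset.prod_univ_sum, Finset.prod_const, Finset.card_univ,
    Fintype.card_fin, inv_pow]
  congr 1
  refine Finset.sum_congr rfl fun z _ => ?_
  simp_rw [h.prod_eq, h.apply_fst, h.apply_snd]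

theorem tendsto_averagedWord_sub_entangledWord_rankOne (h : HasPairs α s t)
    (U : unitary (H →L[ℂ] H)) (x y : Fin (2 * k) → H) (u w : H) :
    Tendsto (fun p : ℕ × Finset (antidiagonalSpectrum U) =>
      inner ℂ u (averagedWord U α p.1 (fun i => InnerProductSpace.rankOne ℂ (x i) (y i)) w) -
      inner ℂ u (entangledWord U α p.2 (fun i => InnerProductSpace.rankOne ℂ (x i) (y i)) w))
      (atTop ×ˢ atTop) (𝓝 0) := by
  simp_rw [inner_averagedWord_rankOne h, inner_entangledWord_rankOne h, ← sub_mul]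
  set v : Fin (2 * k + 1) → H := Fin.cons u y
  choose c hc using fun j => exists_tendsto_pairSum U (v (s j).castSucc) (x (s j))
    (v (t j).castSucc) (x (t j))
  have h1 : ∀ j, Tendsto (fun p : ℕ × Finset (antidiagonalSpectrum U) =>
      pairSum U (v (s j).castSucc) (x (s j)) (v (t j).castSucc) (x (t j)) p.2)
      (atTop ×ˢ atTop) (𝓝 (c j)) := fun j => (hc j).comp tendsto_snd
  have h2 : ∀ j, Tendsto (fun p : ℕ × Finset (antidiagonalSpectrum U) =>
      pairAverage U (v (s j).castSucc) (x (s j)) (v (t j).castSucc) (x (t j)) p.1)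
      (atTop ×ˢ atTop) (𝓝 (c j)) := fun j => by
    simpa using (tendsto_pairAverage_sub_pairSum U (v (s j).castSucc) (x (s j))
      (v (t j).castSucc) (x (t j))).add (h1 j)
  have h3 := (tendsto_finsetProd Finset.univ fun j _ => h2 j).sub
    (tendsto_finsetProd Finset.univ fun j _ => h1 j)
  simpa using h3.mul_const (inner ℂ (v (Fin.last _)) w)

/-- On operators of rank one, the pair containing the first position contributes a vector, the
other pairs contribute scalars. -/
theorem exists_tendsto_entangledWord_rankOne (hk : 1 ≤ k) (h : HasPairs α s t)
    (U : unitary (H →L[ℂ] H)) (x y : Fin (2 * k) → H) :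
    ∃ L, Tendsto (fun F => entangledWord U α F
      (fun i => InnerProductSpace.rankOne ℂ (x i) (y i))) atTop (𝓝 L) := by
  let i₀ : Fin (2 * k) := ⟨0, by omega⟩
  let j₀ := α i₀
  have hs₀ : s j₀ = i₀ := by
    rcases (h.apply_eq_iff i₀ j₀).1 rfl with h0 | h0
    · exact h0.symm
    · exact absurd (h.lt j₀) (by rw [← h0]; simp [i₀, Fin.lt_def])
  have hne : ∀ i : Fin (2 * k), i ≠ i₀ → ∀ u, (Fin.cons u y : Fin (2 * k + 1) → H) i.castSucc =
      (Fin.cons 0 y : Fin (2 * k + 1) → H) i.castSucc := by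
    intro i hi u
    obtain ⟨l, hl⟩ : ∃ l : Fin (2 * k), i.castSucc = l.succ :=
      Fin.exists_succ_eq.2 (fun h0 => hi (Fin.ext (by simpa using congrArg Fin.val h0)))
        |>.imp fun _ h => h.symm
    rw [hl, Fin.cons_succ, Fin.cons_succ]
  have hlast : ∀ u, (Fin.cons u y : Fin (2 * k + 1) → H) (Fin.last _) =
      (Fin.cons 0 y : Fin (2 * k + 1) → H) (Fin.last _) := by
    intro u
    obtain ⟨l, hl⟩ : ∃ l : Fin (2 * k), Fin.last (2 * k) = l.succ :=
      ⟨⟨2 * k - 1, by omega⟩, Fin.ext (by simp; omega)⟩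
    rw [hl, Fin.cons_succ, Fin.cons_succ]
  set v : Fin (2 * k + 1) → H := Fin.cons 0 y with hv
  have key : ∀ F, entangledWord U α F (fun i => InnerProductSpace.rankOne ℂ (x i) (y i)) =
      (∏ j ∈ Finset.univ.erase j₀, pairSum U (v (s j).castSucc) (x (s j)) (v (t j).castSucc)
        (x (t j)) F) •
        InnerProductSpace.rankOne ℂ (pairVector U (x i₀) (v (t j₀).castSucc) (x (t j₀)) F)
          (v (Fin.last _)) := by
    intro F
    ext w
    refine ext_inner_left ℂ fun u => ?_
    rw [inner_entangledWord_rankOne h, hlast u, ← Finset.mul_prod_erase _ _ (Finset.mem_univ j₀),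
      _root_.smul_apply, InnerProductSpace.rankOne_apply, inner_smul_right, inner_smul_right,
      inner_pairVector, hs₀]
    have hcast : (Fin.cons u y : Fin (2 * k + 1) → H) i₀.castSucc = u := rfl
    rw [hcast, hne (t j₀) (by rw [← hs₀]; exact (h.lt j₀).ne')]
    have hprod : ∏ j ∈ Finset.univ.erase j₀,
        pairSum U ((Fin.cons u y : Fin (2 * k + 1) → H) (s j).castSucc) (x (s j))
          ((Fin.cons u y : Fin (2 * k + 1) → H) (t j).castSucc) (x (t j)) F =
        ∏ j ∈ Finset.univ.erase j₀, pairSum U (v (s j).castSucc) (x (s j)) (v (t j).castSucc)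
          (x (t j)) F := by
      refine Finset.prod_congr rfl fun j hj => ?_
      have hj' : j ≠ j₀ := Finset.ne_of_mem_erase hj
      rw [hne (s j) fun h0 => hj' (by rw [← h.apply_fst j, h0]),
        hne (t j) fun h0 => hj' (by rw [← h.apply_snd j, h0])]
    rw [hprod]
    ring
  choose c hc using fun j => exists_tendsto_pairSum U (v (s j).castSucc) (x (s j))
    (v (t j).castSucc) (x (t j))
  obtain ⟨a, ha⟩ := exists_tendsto_pairVector U (x i₀) (v (t j₀).castSucc) (x (t j₀))
  have hcont : Continuous fun b : H => InnerProductSpace.rankOne ℂ b (v (Fin.last (2 * k))) :=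
    ((InnerProductSpace.rankOne ℂ : H →L[ℂ] H →L⋆[ℂ] H →L[ℂ] H).flip _).continuous
  refine ⟨_, Tendsto.congr (fun F => (key F).symm)
    ((tendsto_finsetProd _ fun j _ => hc j).smul ((hcont.tendsto a).comp ha))⟩

/-- Norm convergence for compact operators: the norm bound extends the Cauchy property from the
operators of rank one. -/
theorem exists_tendsto_entangledWord (hk : 1 ≤ k) (h : HasPairs α s t)
    (U : unitary (H →L[ℂ] H)) {A : Fin (2 * k) → H →L[ℂ] H} (hA : ∀ i, IsCompactOperator (A i)) :
    ∃ L, Tendsto (fun F => entangledWord U α F A) atTop (𝓝 L) := by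
  refine CompleteSpace.complete (cauchy_map_iff.2 ⟨inferInstance, ?_⟩)
  rw [tendsto_uniformity_iff_dist_tendsto_zero]
  have key : Tendsto (fun p : Finset (antidiagonalSpectrum U) × Finset (antidiagonalSpectrum U) =>
      (entangledWord U α p.1 - entangledWord U α p.2) A) (atTop ×ˢ atTop) (𝓝 0) := by
    refine tendsto_zero_of_forall_mem_closure_span (C := 2) (D := rankOneOperators H)
      (fun p B => ?_) (fun B hB => ?_) fun i => mem_closure_span_rankOneOperators (hA i)
    · rw [_root_.sub_apply]
      refine (norm_sub_le _ _).trans ?_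
      linarith [norm_entangledWord_le h U p.1 B, norm_entangledWord_le h U p.2 B]
    · choose x y hxy using hB
      obtain rfl : B = fun i => InnerProductSpace.rankOne ℂ (x i) (y i) := funext hxy
      obtain ⟨L, hL⟩ := exists_tendsto_entangledWord_rankOne hk h U x y
      simpa using (hL.comp tendsto_fst).sub (hL.comp tendsto_snd)
  simpa [dist_eq_norm] using key.norm

theorem tendsto_averagedWord_sub_entangledWord (h : HasPairs α s t)
    (U : unitary (H →L[ℂ] H)) {A : Fin (2 * k) → H →L[ℂ] H} (hA : ∀ i, IsCompactOperator (A i))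
    (u w : H) :
    Tendsto (fun p : ℕ × Finset (antidiagonalSpectrum U) =>
      inner ℂ u (averagedWord U α p.1 A w) - inner ℂ u (entangledWord U α p.2 A w))
      (atTop ×ˢ atTop) (𝓝 0) := by
  let ψ : (H →L[ℂ] H) →ₗ[ℂ] ℂ :=
    { toFun := fun B => inner ℂ u (B w)
      map_add' := fun B B' => by simp
      map_smul' := fun c B => by simp }
  have hψ : ∀ B, ‖ψ B‖ ≤ ‖u‖ * ‖w‖ * ‖B‖ := fun B =>
    (norm_inner_le_norm _ _).trans
      ((mul_le_mul_of_nonneg_left (B.le_opNorm w) (norm_nonneg u)).trans_eq (by ring))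
  have key : Tendsto (fun p : ℕ × Finset (antidiagonalSpectrum U) =>
      (ψ.compMultilinearMap (averagedWord U α p.1 - entangledWord U α p.2)) A)
      (atTop ×ˢ atTop) (𝓝 0) := by
    refine tendsto_zero_of_forall_mem_closure_span (C := ‖u‖ * ‖w‖ * 2) (D := rankOneOperators H)
      (fun p B => ?_) (fun B hB => ?_) fun i => mem_closure_span_rankOneOperators (hA i)
    · rw [LinearMap.compMultilinearMap_apply, _root_.sub_apply, mul_assoc _ 2]
      refine (hψ _).trans ?_
      gcongr
      refine (norm_sub_le _ _).trans ?_
      linarith [norm_averagedWord_le (α := α) U p.1 B, norm_entangledWord_le h U p.2 B]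
    · choose x y hxy using hB
      obtain rfl : B = fun i => InnerProductSpace.rankOne ℂ (x i) (y i) := funext hxy
      simpa [ψ, inner_sub_right] using
        tendsto_averagedWord_sub_entangledWord_rankOne h U x y u w
  simpa [ψ, inner_sub_right] using key

end Entangled

end

/-! ### The entangled limit and the trace formula -/

section

/-- A factor on the right is absorbed into the last entry of the list. -/
theorem prod_ofFn_mul_eq {M : Type*} [Monoid M] {n : ℕ} (hn : 0 < n) {f g : Fin n → M} {b : M}
    (h : ∀ i : Fin n, (i : ℕ) < n - 1 → f i = g i)
    (hlast : ∀ i : Fin n, (i : ℕ) = n - 1 → f i * b = g i) :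
    (List.ofFn f).prod * b = (List.ofFn g).prod := by
  obtain ⟨m, rfl⟩ : ∃ m, n = m + 1 := ⟨n - 1, by omega⟩
  have hfg : (fun i : Fin m => f i.castSucc) = fun i => g i.castSucc :=
    funext fun i => h _ (by simp)
  rw [List.ofFn_succ', List.ofFn_succ', List.concat_eq_append, List.concat_eq_append,
    List.prod_append, List.prod_append, hfg, List.prod_singleton, List.prod_singleton, mul_assoc,
    hlast _ (by simp)]

theorem prod_ofFn_mul_last {M : Type*} [Monoid M] {n : ℕ} (hn : 0 < n) {f : Fin (n - 1) → M}
    {g : Fin n → M} {b : M} (h : ∀ (i : Fin n) (hi : (i : ℕ) < n - 1), f ⟨i, hi⟩ = g i)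
    (hlast : ∀ i : Fin n, (i : ℕ) = n - 1 → b = g i) :
    (List.ofFn f).prod * b = (List.ofFn g).prod := by
  obtain ⟨m, rfl⟩ : ∃ m, n = m + 1 := ⟨n - 1, by omega⟩
  have hfg : f = fun i : Fin m => g i.castSucc := funext fun i => h i.castSucc i.2
  rw [List.ofFn_succ' g, List.concat_eq_append, List.prod_append, List.prod_singleton,
    ← hlast (Fin.last m) (by simp), hfg]

variable {H : Type*} [NormedAddCommGroup H] [InnerProductSpace ℂ H]

/-- The family `A_1, …, A_{2k-1}, B`. -/
def extend {k : ℕ} (A : Fin (2 * k - 1) → H →L[ℂ] H) (B : H →L[ℂ] H) (i : Fin (2 * k)) :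
    H →L[ℂ] H :=
  if h : (i : ℕ) < 2 * k - 1 then A ⟨i, h⟩ else B

theorem interlace_mul {k : ℕ} (hk : 1 ≤ k) (A : Fin (2 * k - 1) → H →L[ℂ] H)
    (E : Fin (2 * k) → H →L[ℂ] H) (B : H →L[ℂ] H) : interlace A E * B = word E (extend A B) := by
  rw [interlace, word_apply]
  refine prod_ofFn_mul_eq (by omega) (fun i hi => ?_) (fun i hi => ?_)
  · simp [extend, hi]
  · simp [extend, hi]

theorem isCompactOperator_rankOne (x y : H) :
    IsCompactOperator (InnerProductSpace.rankOne ℂ x y : H →L[ℂ] H) := by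
  have h : IsCompactOperator (innerSL ℂ y : H →L[ℂ] ℂ) := by
    refine ⟨_, isCompact_closedBall (0 : ℂ) 1, ?_⟩
    exact (innerSL ℂ y).continuous.continuousAt.preimage_mem_nhds
      (by simpa using Metric.closedBall_mem_nhds (0 : ℂ) one_pos)
  exact h.clm_comp (ContinuousLinearMap.toSpanSingleton ℂ x)

theorem isCompactOperator_extend {k : ℕ} {A : Fin (2 * k - 1) → H →L[ℂ] H}
    (hA : ∀ i, IsCompactOperator (A i)) {B : H →L[ℂ] H} (hB : IsCompactOperator B)
    (i : Fin (2 * k)) : IsCompactOperator (extend A B i) := by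
  rw [extend]
  split_ifs
  · exact hA _
  · exact hB

theorem mul_rankOne_apply (X : H →L[ℂ] H) (x : H) :
    (X * InnerProductSpace.rankOne ℂ x x) x = (inner ℂ x x : ℂ) • X x := by
  rw [mul_apply_eq_comp, InnerProductSpace.rankOne_apply, map_smul]

theorem summable_norm_sq_mul_apply {ι : Type*} {e : ι → H} (X : H →L[ℂ] H) {R : H →L[ℂ] H}
    (hR : Summable fun i => ‖R (e i)‖ ^ 2) : Summable fun i => ‖(X * R) (e i)‖ ^ 2 := by
  refine Summable.of_nonneg_of_le (fun i => by positivity) (fun i => ?_) (hR.mul_left (‖X‖ ^ 2))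
  rw [← mul_pow]
  gcongr
  exact X.le_opNorm _

theorem norm_inner_apply_le (X : H →L[ℂ] H) (x : H) :
    ‖(inner ℂ x (X x) : ℂ)‖ ≤ ‖X‖ * ‖x‖ ^ 2 :=
  (norm_inner_le_norm _ _).trans
    ((mul_le_mul_of_nonneg_left (X.le_opNorm x) (norm_nonneg x)).trans_eq (by ring))

/-- The matrix entries of a Hilbert–Schmidt operator are square summable. -/
theorem summable_norm_sq_inner {ι : Type*} (e : HilbertBasis ι ℂ H) {R : H →L[ℂ] H} (hR : Summable fun i => ‖R (e i)‖ ^ 2) :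
    Summable fun p : ι × ι => ‖(inner ℂ (e p.2) (R (e p.1)) : ℂ)‖ ^ 2 := by
  have h : ∀ x, HasSum (fun j => ‖(inner ℂ (e j) x : ℂ)‖ ^ 2) (‖x‖ ^ 2) := by
    intro x
    have h1 := e.hasSum_inner_mul_inner x x
    have h2 : (fun j => inner ℂ x (e j) * inner ℂ (e j) x) =
        fun j => ((‖(inner ℂ (e j) x : ℂ)‖ ^ 2 : ℝ) : ℂ) := by
      funext j
      rw [← inner_conj_symm x, Complex.conj_mul']
      push_cast
      rfl
    have h3 : inner ℂ x x = ((‖x‖ ^ 2 : ℝ) : ℂ) := by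
      rw [inner_self_eq_norm_sq_to_K]
      push_cast
      rfl
    rw [h2, h3] at h1
    exact Complex.hasSum_ofReal.1 h1
  refine (summable_prod_of_nonneg fun p => sq_nonneg _).2 ⟨fun i => (h (R (e i))).summable, ?_⟩
  exact hR.congr fun i => (h (R (e i))).tsum_eq.symm

variable [CompleteSpace H]

theorem partialEntangled_mul {k : ℕ} (hk : 1 ≤ k) (U : unitary (H →L[ℂ] H))
    (α : Fin (2 * k) → Fin k) (A : Fin (2 * k - 1) → H →L[ℂ] H) (B : H →L[ℂ] H)
    (F : Finset (antidiagonalSpectrum U)) :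
    partialEntangled U α A F * B = entangledWord U α F (extend A B) := by
  simp only [partialEntangled, entangledWord, Finset.sum_mul, interlace_mul hk, _root_.sum_apply]

/-- The time averages of `U^{n_α(1)} A_1 ⋯ A_{2k-1} U^{n_α(2k)}`. -/
def averagedInterlace {k : ℕ} (U : unitary (H →L[ℂ] H)) (α : Fin (2 * k) → Fin k)
    (A : Fin (2 * k - 1) → H →L[ℂ] H) (N : ℕ) : H →L[ℂ] H :=
  ((N : ℂ) ^ k)⁻¹ • ∑ n ∈ Fintype.piFinset (fun _ : Fin k => Finset.range N),
    interlace A fun i => (U : H →L[ℂ] H) ^ n (α i)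

theorem averagedInterlace_mul {k : ℕ} (hk : 1 ≤ k) (U : unitary (H →L[ℂ] H))
    (α : Fin (2 * k) → Fin k) (A : Fin (2 * k - 1) → H →L[ℂ] H) (B : H →L[ℂ] H) (N : ℕ) :
    averagedInterlace U α A N * B = averagedWord U α N (extend A B) := by
  simp only [averagedInterlace, averagedWord, smul_mul_assoc, Finset.sum_mul, interlace_mul hk,
    _root_.sum_apply, _root_.smul_apply]

/-- Strong convergence of the net `S^F`: appending the rank one operator `|x⟩⟨x|` turns the value at
`x` into a word in compact operators only, which converges in norm. -/
theorem exists_isEntangledLimit {k : ℕ} (hk : 1 ≤ k) (U : unitary (H →L[ℂ] H))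
    {α : Fin (2 * k) → Fin k} (hα : IsPairPartition α) {A : Fin (2 * k - 1) → H →L[ℂ] H}
    (hA : ∀ i, IsCompactOperator (A i)) : ∃ S, IsEntangledLimit U α A S := by
  obtain ⟨s, t, h⟩ := hα.exists_hasPairs
  have hlim : ∀ x, ∃ y, Tendsto (fun F => partialEntangled U α A F x) atTop (𝓝 y) := by
    intro x
    by_cases hx : x = 0
    · exact ⟨0, by simp [hx]⟩
    obtain ⟨L, hL⟩ := exists_tendsto_entangledWord hk h U
      (isCompactOperator_extend hA (isCompactOperator_rankOne x x))
    refine ⟨(inner ℂ x x : ℂ)⁻¹ • L x, ?_⟩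
    refine (((ContinuousLinearMap.apply ℂ H x).continuous.tendsto L).comp hL).const_smul _
      |>.congr fun F => ?_
    simp only [Function.comp_apply, ContinuousLinearMap.apply_apply, ← partialEntangled_mul hk]
    rw [mul_rankOne_apply, smul_smul, inv_mul_cancel₀ (by simpa using hx), one_smul]
  choose f hf using hlim
  let S := linearMapOfTendsto f (fun F => (partialEntangled U α A F : H →ₗ[ℂ] H))
    (tendsto_pi_nhds.2 hf)
  refine ⟨S.mkContinuous (∏ i, ‖extend A 1 i‖) fun x => ?_, hf⟩
  refine le_of_tendsto' (hf x).norm fun F => ?_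
  refine ContinuousLinearMap.le_of_opNorm_le _ ?_ x
  have := norm_entangledWord_le h U F (extend A 1)
  rwa [← partialEntangled_mul hk, mul_one] at this

/-- The time averages converge to `S` in the weak operator topology. -/
theorem tendsto_inner_averagedInterlace {k : ℕ} (hk : 1 ≤ k) (U : unitary (H →L[ℂ] H))
    {α : Fin (2 * k) → Fin k} (hα : IsPairPartition α) {A : Fin (2 * k - 1) → H →L[ℂ] H}
    (hA : ∀ i, IsCompactOperator (A i)) {S : H →L[ℂ] H} (hS : IsEntangledLimit U α A S)
    (u w : H) :
    Tendsto (fun N => inner ℂ u (averagedInterlace U α A N w)) atTop (𝓝 (inner ℂ u (S w))) := by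
  obtain ⟨s, t, h⟩ := hα.exists_hasPairs
  by_cases hw : w = 0
  · simp [hw]
  have hc : (inner ℂ w w : ℂ) ≠ 0 := by simpa using hw
  have h1 := tendsto_averagedWord_sub_entangledWord h U
    (isCompactOperator_extend hA (isCompactOperator_rankOne w w)) u w
  simp only [← partialEntangled_mul hk, ← averagedInterlace_mul hk, mul_rankOne_apply,
    inner_smul_right, ← mul_sub] at h1
  have h2 : Tendsto (fun p : ℕ × Finset (antidiagonalSpectrum U) =>
      (inner ℂ u (partialEntangled U α A p.2 w) : ℂ)) (atTop ×ˢ atTop) (𝓝 (inner ℂ u (S w))) :=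
    (tendsto_const_nhds.inner (hS w)).comp tendsto_snd
  have h3 : Tendsto ((fun N => (inner ℂ u (averagedInterlace U α A N w) : ℂ)) ∘ Prod.fst)
      ((atTop : Filter ℕ) ×ˢ (atTop : Filter (Finset (antidiagonalSpectrum U))))
      (𝓝 (inner ℂ u (S w))) := by
    have h4 := (h1.const_mul (inner ℂ w w : ℂ)⁻¹).add h2
    rw [mul_zero, zero_add] at h4
    refine h4.congr fun p => ?_
    rw [inv_mul_cancel_left₀ hc, sub_add_cancel]
    rfl
  rwa [← tendsto_map'_iff, map_fst_prod] at h3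

theorem norm_averagedInterlace_le {k : ℕ} (hk : 1 ≤ k) (U : unitary (H →L[ℂ] H))
    (α : Fin (2 * k) → Fin k) (A : Fin (2 * k - 1) → H →L[ℂ] H) (N : ℕ) :
    ‖averagedInterlace U α A N‖ ≤ ∏ i, ‖extend A 1 i‖ := by
  have := norm_averagedWord_le (α := α) U N (extend A 1)
  rwa [← averagedInterlace_mul hk, mul_one] at this

section Correlation

theorem ad_pow_apply (U : unitary (H →L[ℂ] H)) (n : ℕ) (A : H →L[ℂ] H) :
    (ad U ^ n) A = (U : H →L[ℂ] H) ^ n * A * star ((U : H →L[ℂ] H) ^ n) := by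
  rw [ad, ← map_pow, Unitary.conjStarAlgAut_apply]
  simp

theorem star_pow_mul_pow_add (U : unitary (H →L[ℂ] H)) (m n : ℕ) :
    star ((U : H →L[ℂ] H) ^ m) * (U : H →L[ℂ] H) ^ (m + n) = (U : H →L[ℂ] H) ^ n := by
  have : star ((U : H →L[ℂ] H) ^ m) * (U : H →L[ℂ] H) ^ m = 1 := by
    simpa using Unitary.star_mul_self_of_mem (U ^ m).2
  rw [pow_add, ← mul_assoc, this, one_mul]

/-- The powers of `U` telescope in a product of translates of operators. -/
theorem prod_ad_pow (U : unitary (H →L[ℂ] H)) (q : ℕ → ℕ) {n : ℕ} (A : Fin n → H →L[ℂ] H) :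
    (List.ofFn fun i : Fin n => (ad U ^ (∑ l ∈ Finset.range (i + 1), q l)) (A i)).prod =
      word (fun i => (U : H →L[ℂ] H) ^ q i) A *
        star ((U : H →L[ℂ] H) ^ (∑ l ∈ Finset.range n, q l)) := by
  rw [word_apply]
  induction n with
  | zero => simp
  | succ n ih =>
    have h := ih fun i => A i.castSucc
    rw [List.ofFn_succ', List.ofFn_succ', List.concat_eq_append, List.concat_eq_append,
      List.prod_append, List.prod_append, List.prod_singleton, List.prod_singleton]
    simp only [Fin.val_castSucc, Fin.val_last] at h ⊢
    rw [h, ad_pow_apply, mul_assoc, ← mul_assoc (star _), ← mul_assoc (star _),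
      Finset.sum_range_succ, star_pow_mul_pow_add]
    simp only [mul_assoc]

/-- The correlation operator with its telescoping powers of `U` cancelled; the exponents
`n_α(1), …, n_α(2k)` add up to `∑ 2 n_i` since `α` takes each value twice. -/
theorem correlation_eq {k : ℕ} (hk : 1 ≤ k) (U : unitary (H →L[ℂ] H)) {α : Fin (2 * k) → Fin k}
    (hα : IsPairPartition α) (B : H →L[ℂ] H) (A : Fin (2 * k - 1) → H →L[ℂ] H) (C : H →L[ℂ] H)
    (n : Fin k → ℕ) :
    correlation (ad U) α B A C n =
      B * (interlace A fun i => (U : H →L[ℂ] H) ^ n (α i)) * C *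
        star ((U : H →L[ℂ] H) ^ (∑ i, 2 * n i)) := by
  obtain ⟨s, t, h⟩ := hα.exists_hasPairs
  let q : ℕ → ℕ := fun l => if hl : l < 2 * k then n (α ⟨l, hl⟩) else 0
  have hq : ∀ l : Fin (2 * k), q l = n (α l) := fun l => by simp [q]
  have hpartial : ∀ m < 2 * k, ∑ l ∈ Finset.univ.filter (fun l : Fin (2 * k) => (l : ℕ) ≤ m),
      n (α l) = ∑ l ∈ Finset.range (m + 1), q l := by
    intro m hm
    rw [Finset.sum_filter]
    simp_rw [← hq]
    rw [Fin.sum_univ_eq_sum_range (fun l => if l ≤ m then q l else 0), ← Finset.sum_filter]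
    refine Finset.sum_congr ?_ fun _ _ => rfl
    ext l
    simp only [Finset.mem_filter, Finset.mem_range]
    omega
  have htotal : ∑ i, 2 * n i = ∑ l ∈ Finset.range (2 * k), q l := by
    rw [← Fin.sum_univ_eq_sum_range q]
    simp_rw [hq]
    rw [h.sum_eq]
    simp_rw [h.apply_fst, h.apply_snd, two_mul]
  have hprod : (List.ofFn fun i : Fin (2 * k - 1) => (ad U ^ (∑ l ∈ Finset.univ.filter
      (fun l : Fin (2 * k) => (l : ℕ) ≤ (i : ℕ)), n (α l))) (A i)).prod *
      (ad U ^ (∑ i : Fin k, 2 * n i)) C =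
      (List.ofFn fun i : Fin (2 * k) =>
        (ad U ^ (∑ l ∈ Finset.range (i + 1), q l)) (extend A C i)).prod := by
    refine prod_ofFn_mul_last (by omega) (fun i hi => ?_) fun i hi => ?_
    · rw [hpartial i i.2, extend, dif_pos hi]
    · rw [htotal, extend, dif_neg (by omega), hi, Nat.sub_add_cancel (by omega)]
  rw [correlation, mul_assoc, hprod, prod_ad_pow, htotal]
  simp_rw [hq]
  rw [← interlace_mul hk]
  simp only [mul_assoc]

end Correlation

section Trace

variable {ι : Type*} (e : HilbertBasis ι ℂ H)

/-- The square root of a density matrix supported in the `U`-invariant vectors is a selfadjoint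
Hilbert–Schmidt operator whose range consists of `U`-invariant vectors. -/
theorem exists_sqrt {U : unitary (H →L[ℂ] H)} {T : H →L[ℂ] H} (hT : IsDensityMatrix e T)
    (hTU : IsSupportedInInvariants U T) :
    ∃ R : H →L[ℂ] H, IsSelfAdjoint R ∧ R * R = T ∧ Summable (fun i => ‖R (e i)‖ ^ 2) ∧
      ∀ x, (U : H →L[ℂ] H) (R x) = R x := by
  have hT0 : 0 ≤ T := (ContinuousLinearMap.nonneg_iff_isPositive T).2 hT.1
  have hR : IsSelfAdjoint (CFC.sqrt T) := IsSelfAdjoint.of_nonneg (CFC.sqrt_nonneg T)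
  have hRR : CFC.sqrt T * CFC.sqrt T = T := CFC.sqrt_mul_sqrt_self T hT0
  set R := CFC.sqrt T
  have hsymm : ∀ x y, inner ℂ (R x) y = inner ℂ x (R y) := fun x y => by
    rw [← ContinuousLinearMap.adjoint_inner_right, ContinuousLinearMap.isSelfAdjoint_iff'.1 hR]
  have hnorm : ∀ x, inner ℂ x (T x) = ((‖R x‖ ^ 2 : ℝ) : ℂ) := fun x => by
    rw [← hRR, mul_apply_eq_comp, ← hsymm, inner_self_eq_norm_sq_to_K]
    push_cast
    rfl
  refine ⟨R, hR, hRR, ?_, fun x => ?_⟩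
  · have h := hT.2.summable
    simp_rw [hnorm] at h
    exact_mod_cast h
  · have hmem : R x ∈ eigenspaceOf U 1 := by
      refine hTU ((Submodule.mem_orthogonal _ _).2 fun v hv => ?_)
      have hv0 : R v = 0 := by
        have h := hnorm v
        rw [show T v = 0 from hv, inner_zero_right] at h
        simpa using (Complex.ofReal_eq_zero.1 h.symm)
      rw [← hsymm, hv0, inner_zero_left]
    simpa using mem_eigenspaceOf.1 hmem

/-- Cyclicity of the trace, for a product of two Hilbert–Schmidt operators. -/
theorem tsum_inner_mul_comm {R X : H →L[ℂ] H} (hRsa : IsSelfAdjoint R)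
    (hR : Summable fun i => ‖R (e i)‖ ^ 2) :
    ∑' i, inner ℂ (e i) ((R * R * X) (e i)) = ∑' i, inner ℂ (R (e i)) (X (R (e i))) := by
  have hsymm : ∀ x y, inner ℂ (R x) y = inner ℂ x (R y) := fun x y => by
    rw [← ContinuousLinearMap.adjoint_inner_right, ContinuousLinearMap.isSelfAdjoint_iff'.1 hRsa]
  set Y := ContinuousLinearMap.adjoint X * R
  have hY : ∀ i j, inner ℂ (e j) (R (X (e i))) = inner ℂ (Y (e j)) (e i) := fun i j => by
    rw [← hsymm, mul_apply_eq_comp, ContinuousLinearMap.adjoint_inner_left]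
  let f : ι × ι → ℂ := fun p => inner ℂ (R (e p.1)) (e p.2) * inner ℂ (Y (e p.2)) (e p.1)
  have hf : Summable f := by
    have h1 := summable_norm_sq_inner e hR
    have h2 := (summable_norm_sq_inner e (summable_norm_sq_mul_apply
      (ContinuousLinearMap.adjoint X) hR)).prod_symm
    refine Summable.of_norm_bounded (h1.add h2) fun p => ?_
    rw [norm_mul, norm_inner_symm (R (e p.1)), norm_inner_symm (Y (e p.2))]
    change _ ≤ ‖(inner ℂ (e p.2) (R (e p.1)) : ℂ)‖ ^ 2 + ‖(inner ℂ (e p.1) (Y (e p.2)) : ℂ)‖ ^ 2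
    nlinarith [sq_nonneg (‖(inner ℂ (e p.2) (R (e p.1)) : ℂ)‖ -
      ‖(inner ℂ (e p.1) (Y (e p.2)) : ℂ)‖), sq_nonneg ‖(inner ℂ (e p.2) (R (e p.1)) : ℂ)‖,
      sq_nonneg ‖(inner ℂ (e p.1) (Y (e p.2)) : ℂ)‖]
  have hleft : ∀ i, inner ℂ (e i) ((R * R * X) (e i)) = ∑' j, f (i, j) := fun i => by
    rw [mul_apply_eq_comp, mul_apply_eq_comp, ← hsymm,
      ← (e.hasSum_inner_mul_inner (R (e i)) (R (X (e i)))).tsum_eq]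
    exact tsum_congr fun j => by rw [hY]
  have hright : ∀ j, inner ℂ (R (e j)) (X (R (e j))) = ∑' i, f (i, j) := fun j => by
    rw [← ContinuousLinearMap.adjoint_inner_left, ← mul_apply_eq_comp,
      ← (e.hasSum_inner_mul_inner (Y (e j)) (R (e j))).tsum_eq]
    exact tsum_congr fun i => by rw [← hsymm, mul_comm]
  simp_rw [hleft, hright]
  exact (Summable.tsum_comm (f := fun i j => f (i, j)) hf).symm

theorem trace_mul_eq {R T : H →L[ℂ] H} (hRsa : IsSelfAdjoint R) (hRR : R * R = T)
    (hR : Summable fun i => ‖R (e i)‖ ^ 2) (X : H →L[ℂ] H) :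
    trace e (T * X) = ∑' i, inner ℂ (R (e i)) (X (R (e i))) := by
  rw [trace, ← hRR, tsum_inner_mul_comm e hRsa hR]

end Trace

end

end EntangledErgodic

end

theorem theorem4p2 {H : Type*} [NormedAddCommGroup H] [InnerProductSpace ℂ H] [CompleteSpace H]
    {ι : Type*} (e : HilbertBasis ι ℂ H)
    (U : unitary (H →L[ℂ] H)) (T : H →L[ℂ] H)
    (hT : EntangledErgodic.IsDensityMatrix e T)
    (hTU : EntangledErgodic.IsSupportedInInvariants U T)
    (k : ℕ) (hk : 1 ≤ k) (α : Fin (2 * k) → Fin k) (hα : EntangledErgodic.IsPairPartition α)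
    (A₀ A₂ₖ : H →L[ℂ] H) (A : Fin (2 * k - 1) → (H →L[ℂ] H))
    (hA : ∀ i, IsCompactOperator (A i)) :
    ∃ S : H →L[ℂ] H, EntangledErgodic.IsEntangledLimit U α A S ∧
      Tendsto
        (fun N : ℕ => (1 / (N : ℂ) ^ k) *
          ∑ n ∈ Fintype.piFinset (fun _ : Fin k => Finset.range N),
            EntangledErgodic.trace e
              (T * EntangledErgodic.correlation (EntangledErgodic.ad U) α A₀ A A₂ₖ n))
        atTop (𝓝 (EntangledErgodic.trace e (T * (A₀ * S * A₂ₖ)))) := by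
  open EntangledErgodic in
  obtain ⟨S, hS⟩ := exists_isEntangledLimit hk U hα hA
  refine ⟨S, hS, ?_⟩
  obtain ⟨R, hRsa, hRR, hR, hUR⟩ := exists_sqrt e hT hTU
  have hUstar : ∀ m x, star ((U : H →L[ℂ] H) ^ m) (R x) = R x := by
    intro m x
    have hpow : ((U : H →L[ℂ] H) ^ m) (R x) = R x := by
      induction m with
      | zero => simp
      | succ m ih => rw [pow_succ', mul_apply_eq_comp, ih, hUR]
    conv_lhs => rw [← hpow, ← mul_apply_eq_comp]
    have := star_pow_mul_pow_add U m 0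
    rw [add_zero, pow_zero] at this
    rw [this, one_apply_eq_self]
  -- by cyclicity the last power of `U` is absorbed into the state
  have htrace : ∀ n, trace e (T * correlation (ad U) α A₀ A A₂ₖ n) =
      ∑' i, inner ℂ (R (e i))
        ((A₀ * (interlace A fun i => (U : H →L[ℂ] H) ^ n (α i)) * A₂ₖ) (R (e i))) := by
    intro n
    rw [trace_mul_eq e hRsa hRR hR, correlation_eq hk U hα]
    refine tsum_congr fun i => ?_
    rw [mul_apply_eq_comp _ (star _), hUstar]
  have hsummable : ∀ X : H →L[ℂ] H, Summable fun i => (inner ℂ (R (e i)) (X (R (e i))) : ℂ) :=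
    fun X => Summable.of_norm_bounded (hR.mul_left ‖X‖) fun i => norm_inner_apply_le X _
  have haverage : ∀ N : ℕ, (1 / (N : ℂ) ^ k) *
      ∑ n ∈ Fintype.piFinset (fun _ : Fin k => Finset.range N),
        trace e (T * correlation (ad U) α A₀ A A₂ₖ n) =
      ∑' i, inner ℂ (R (e i)) ((A₀ * averagedInterlace U α A N * A₂ₖ) (R (e i))) := by
    intro N
    simp_rw [htrace]
    rw [← Summable.tsum_finsetSum fun n _ => hsummable _, ← tsum_mul_left]
    refine tsum_congr fun i => ?_
    have h1 : A₀ * averagedInterlace U α A N * A₂ₖ = ((N : ℂ) ^ k)⁻¹ •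
        ∑ n ∈ Fintype.piFinset (fun _ : Fin k => Finset.range N),
          A₀ * (interlace A fun i => (U : H →L[ℂ] H) ^ n (α i)) * A₂ₖ := by
      rw [averagedInterlace, mul_smul_comm, smul_mul_assoc, Finset.mul_sum, Finset.sum_mul]
    rw [h1, _root_.smul_apply, _root_.sum_apply, inner_smul_right, inner_sum, one_div]
  simp_rw [haverage]
  rw [trace_mul_eq e hRsa hRR hR]
  refine tendsto_tsum_of_dominated_convergence
    (bound := fun i => ‖A₀‖ * (∏ i, ‖extend A 1 i‖) * ‖A₂ₖ‖ * ‖R (e i)‖ ^ 2) (hR.mul_left _)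
    (fun i => ?_) (Eventually.of_forall fun N i => (norm_inner_apply_le _ _).trans ?_)
  · simp only [mul_apply_eq_comp]
    simp_rw [← ContinuousLinearMap.adjoint_inner_left A₀]
    exact tendsto_inner_averagedInterlace hk U hα hA hS _ _
  · gcongr
    refine (norm_mul_le _ _).trans ?_
    gcongr
    refine (norm_mul_le _ _).trans ?_
    gcongr
    exact norm_averagedInterlace_le hk U α A N
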